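/- Let $F$ be a field, let $m,s\ge 1$ and $n=ms$, and let $H=(\alpha_{i+j})_{0\le i,j\le m-1}\in F^{n\times n}$ be a non-singular block-Hankel matrix with blocks $\alpha_0,\dots,\alpha_{2m-2}\in F^{s\times s}$; let $\alpha_{2m-1}\in F^{s\times s}$ be arbitrary. The off-diagonal representation of $H^{-1}$ consists of the $s\times s$ blocks $q_k,q^*_k$ ($0\le k\le m-1$) and $v_k,v^*_k$ ($1\le k\le m$) that are the solutions of $$H\begin{bmatrix}q_{m-1}\\ \vdots\\ q_0\end{bmatrix}=\begin{bmatrix}0\\ \vdots\\ 0\\ I\end{bmatrix},\qquad H\begin{bmatrix}v_m\\ \vdots\\ v_1\end{bmatrix}=-\begin{bmatrix}\alpha_m\\ \vdots\\ \alpha_{2m-1}\end{bmatrix},$$ $$[q^*_{m-1}\ \cdots\ q^*_0]\,H=[0\ \cdots\ 0\ I],\qquad [v^*_m\ \cdots\ v^*_1]\,H=-[\alpha_m\ \cdots\ \alpha_{2m-1}].$$ The cost of a computation is the number of arithmetic operations $+,-,\times,/$ in $F$ performed by a straight-line program over $F$ (constants of $F$ are free, and divisors vanish on no admissible input). The program may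 depend on $F,m,s$, but not on $H$, the representation, or $M$. Suppose that the representation of $H^{-1}$ and an arbitrary $M\in F^{n\times n}$ are given. Then: 1. Computing $H^{-1}M$ reduces to four products of an $s\times s$ by an $s\times n$ polynomial matrix of degree $O(m)$: there is a straight-line program that computes it with four such products, of matrices of degree at most $m$, and at most $n^2$ further operations in $F$. 2. Let $\nu,\tau\in\mathbb R$ be such that an $s\times s$ by $s\times\lfloor s^\nu\rfloor$ matrix product over $F$ can be computed with $O(s^{\tau})$ operations for all $s\ge1$, that is, $\tau$ is an admissible value of $\omega(1,1,\nu)$. Then there are constants $C,k$ depending only on $F,\nu,\tau$ such that $H^{-1}M$ can be computed with at most $C\,s^{\tau}m\,(1+\log n)^k$ operations, i.e. with $\tilde O(s^{\omega(1,1,\nu)}m)$ operations, for all $m,s\ge1$ with $n=ms\le s^\nu$ (in particular when $n=s^\nu$). 3. Let $\omega\in\mathbb R$ be such that two $s\times s$ matrices over $F$ can be multiplied with $O(s^\omega)$ operations for all $s\ge 1$. Then there are constants $C,k$ depending only on $F,\omega$ such that, for all $m,s\ge1$, $H^{-1}M$ can be computed with at most $C\,s^{\omega}m^2(1+\log n)^k$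 operations, i.e. with $\tilde O(s^\omega m^2)$ operations. -/

import Mathlib

/-! ### Straight-line programs over a field

A straight-line program is run on an input `x` ranging over a set `X` of admissible inputs; every
value that it computes is a function `X → F`, and programs are described through the set of the
values computed so far. -/

/-- `StraightLine Γ I a p S`: there is a straight-line program over `F` which, starting from the
input values `I` and the constants of `F`, performs `a` arithmetic operations in `F` and `p` calls
of the subroutine `Γ`, and after which `S` is the set of all available values.
A division is only allowed if the divisor vanishes on no admissible input.
`Γ S T` says that one call of the subroutine, on arguments taken from the available values `S`,
may return the values `T`. -/
inductive StraightLine {F X : Type*} [Field F]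
    (Γ : Set (X → F) → Set (X → F) → Prop) (I : Set (X → F)) : ℕ → ℕ → Set (X → F) → Prop
  | start : StraightLine Γ I 0 0 (I ∪ {f | ∃ c : F, f = fun _ => c})
  | add {a p : ℕ} {S : Set (X → F)} {f g : X → F} (h : StraightLine Γ I a p S)
      (hf : f ∈ S) (hg : g ∈ S) : StraightLine Γ I (a + 1) p (insert (fun x => f x + g x) S)
  | sub {a p : ℕ} {S : Set (X → F)} {f g : X → F} (h : StraightLine Γ I a p S)
      (hf : f ∈ S) (hg : g ∈ S) : StraightLine Γ I (a + 1) p (insert (fun x => f x - g x) S)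
  | mul {a p : ℕ} {S : Set (X → F)} {f g : X → F} (h : StraightLine Γ I a p S)
      (hf : f ∈ S) (hg : g ∈ S) : StraightLine Γ I (a + 1) p (insert (fun x => f x * g x) S)
  | div {a p : ℕ} {S : Set (X → F)} {f g : X → F} (h : StraightLine Γ I a p S)
      (hf : f ∈ S) (hg : g ∈ S) (hg0 : ∀ x, g x ≠ 0) :
      StraightLine Γ I (a + 1) p (insert (fun x => f x / g x) S)
  | call {a p : ℕ} {S T : Set (X → F)} (h : StraightLine Γ I a p S) (hT : Γ S T) :
      StraightLine Γ I a (p + 1) (S ∪ T)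

/-- The values `O` can be computed from the values `I` with at most `t` arithmetic operations in
`F` (and without any subroutine). -/
def CostLE {F X : Type*} [Field F] (I O : Set (X → F)) (t : ℝ) : Prop :=
  ∃ (a : ℕ) (S : Set (X → F)),
    StraightLine (fun _ _ => False) I a 0 S ∧ O ⊆ S ∧ (a : ℝ) ≤ t

/-- The subroutine which multiplies an `s × s` by an `s × n` polynomial matrix, both of degree at
most `d`: its arguments are the coefficients of the entries of the two factors, and it returns the
coefficients of the entries of their product. -/
def PolyMatProd {F X : Type*} [Field F] (d s n : ℕ) (S T : Set (X → F)) : Prop :=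
  ∃ (P : Matrix (Fin s) (Fin s) (Polynomial (X → F)))
    (R : Matrix (Fin s) (Fin n) (Polynomial (X → F))),
    (∀ i j, (P i j).natDegree ≤ d ∧ ∀ k, (P i j).coeff k ∈ S) ∧
    (∀ i j, (R i j).natDegree ≤ d ∧ ∀ k, (R i j).coeff k ∈ S) ∧
    T = {f | ∃ i j k, f = ((P * R) i j).coeff k}

/-! ### Exponents of matrix multiplication -/

/-- An `a × b` by a `b × c` matrix over `F` can be multiplied with at most `t` operations in `F`. -/
def MatMulCostLE (F : Type*) [Field F] (a b c : ℕ) (t : ℝ) : Prop :=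
  CostLE (X := Matrix (Fin a) (Fin b) F × Matrix (Fin b) (Fin c) F)
    ({f | ∃ i j, f = fun x => x.1 i j} ∪ {f | ∃ i j, f = fun x => x.2 i j})
    {f | ∃ i j, f = fun x => (x.1 * x.2) i j} t

/-- `ω` is an admissible exponent of square matrix multiplication over `F`: two `s × s` matrices can
be multiplied with `O(s ^ ω)` operations. -/
def IsMatMulExponent (F : Type*) [Field F] (ω : ℝ) : Prop :=
  ∃ c : ℝ, ∀ s : ℕ, 0 < s → MatMulCostLE F s s s (c * (s : ℝ) ^ ω)

/-- `τ` is an admissible value of `ω(1,1,ν)` over `F`: an `s × s` matrix can be multiplied by an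
`s × n` matrix, where `n` is `s ^ ν` rounded down, with `O(s ^ τ)` operations. -/
def IsRectMatMulExponent (F : Type*) [Field F] (ν τ : ℝ) : Prop :=
  ∃ c : ℝ, ∀ s : ℕ, 0 < s → MatMulCostLE F s s ⌊(s : ℝ) ^ ν⌋₊ (c * (s : ℝ) ^ τ)

/-! ### Block-Hankel matrices

A matrix with `m * s` rows, cut into `m` blocks of `s` consecutive rows, has its rows indexed by
`Fin m × Fin s`. -/

/-- The block-Hankel matrix with `s × s` block `α (i + j)` in block position `(i, j)`. -/
def blockHankel {F : Type*} [Field F] (m s : ℕ) (α : ℕ → Matrix (Fin s) (Fin s) F) :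
    Matrix (Fin m × Fin s) (Fin m × Fin s) F :=
  Matrix.of fun i j => α (i.1 + j.1) i.2 j.2

/-- The block column with blocks `b 0, …, b (m - 1)`. -/
def blockCol {F : Type*} [Field F] (m s : ℕ) (b : ℕ → Matrix (Fin s) (Fin s) F) :
    Matrix (Fin m × Fin s) (Fin s) F :=
  Matrix.of fun i j => b i.1 i.2 j

/-- The block row with blocks `b 0, …, b (m - 1)`. -/
def blockRow {F : Type*} [Field F] (m s : ℕ) (b : ℕ → Matrix (Fin s) (Fin s) F) :
    Matrix (Fin s) (Fin m × Fin s) F :=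
  Matrix.of fun i j => b j.1 i j.2

/-- An admissible input of the problem: a nonsingular block-Hankel matrix `H` with blocks
`α 0, …, α (2 * m - 2)`, an arbitrary further block `α (2 * m - 1)`, the blocks `q k`, `qs k`
(`0 ≤ k < m`) and `v k`, `vs k` (`1 ≤ k ≤ m`) of the off-diagonal representation of `H⁻¹`, which
are the solutions of four linear systems, and a matrix `M` with `m * s` rows and columns.
The other members of the five sequences play no role. -/
structure HankelInput (F : Type*) [Field F] (m s : ℕ) where
  α : ℕ → Matrix (Fin s) (Fin s) F
  q : ℕ → Matrix (Fin s) (Fin s) F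
  v : ℕ → Matrix (Fin s) (Fin s) F
  qs : ℕ → Matrix (Fin s) (Fin s) F
  vs : ℕ → Matrix (Fin s) (Fin s) F
  M : Matrix (Fin m × Fin s) (Fin (m * s)) F
  nonsing : IsUnit (blockHankel m s α).det
  q_eq : blockHankel m s α * blockCol m s (fun j => q (m - 1 - j))
    = blockCol m s (fun i => if i = m - 1 then 1 else 0)
  v_eq : blockHankel m s α * blockCol m s (fun j => v (m - j))
    = -blockCol m s (fun i => α (m + i))
  qs_eq : blockRow m s (fun j => qs (m - 1 - j)) * blockHankel m s α
    = blockRow m s (fun i => if i = m - 1 then 1 else 0)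
  vs_eq : blockRow m s (fun j => vs (m - j)) * blockHankel m s α
    = -blockRow m s (fun i => α (m + i))

/-- What is given: the entries of the blocks of the representation of `H⁻¹` and of `M`. -/
def givenValues (F : Type*) [Field F] (m s : ℕ) : Set (HankelInput F m s → F) :=
  {f | ∃ k i j, k < m ∧ f = fun x => x.q k i j} ∪
  {f | ∃ k i j, 1 ≤ k ∧ k ≤ m ∧ f = fun x => x.v k i j} ∪
  {f | ∃ k i j, k < m ∧ f = fun x => x.qs k i j} ∪
  {f | ∃ k i j, 1 ≤ k ∧ k ≤ m ∧ f = fun x => x.vs k i j} ∪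
  {f | ∃ i j, f = fun x => x.M i j}

/-- What is to be computed: the entries of `H⁻¹ * M`. -/
def wantedValues (F : Type*) [Field F] (m s : ℕ) : Set (HankelInput F m s → F) :=
  {f | ∃ i j, f = fun x => ((blockHankel m s x.α)⁻¹ * x.M) i j}

/-! ### Calculus of straight-line programs -/

section Programs

variable {F X : Type*} [Field F]

/-! Shifting a block-Hankel matrix up by one block row or left by one block column gives the same
blocks away from its last block row and column. Hence the displacement of `H⁻¹` under block shifts
has block rank at most two, and its factors are the four given solutions
(`hankel_inverse_displacement`). The last block row of `H⁻¹` consists of the `qs k`; climbing from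
it along antidiagonals writes `H⁻¹` as a difference of two products, each of a triangular
block-Hankel matrix in the `v k` or `q k` by a triangular block-Toeplitz matrix in the `qs k` or `vs
k` (`hankel_inverse_apply`). Each of these four factors acts through a range of coefficients of one
polynomial matrix product, and one subtraction per entry remains
(`exists_straightLine_inverse_mul`).

The polynomial products must be fast over every field, without roots of unity in `F`. As in the
method of Schönhage and Strassen, a convolution of length `p ^ k` is cut into about `p ^ (k / 2)`
chunks, and the roots of unity are index shifts in a cyclic group algebra of `p`-power order, where
`p` is 2 or 3 and nonzero in `F`. Recursion gives a quasi-linear number of operations in any space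
with a bilinear product (`IsCostModel.cyclicConv_fast`). For matrices each such operation is charged
as one `s × s` by `s × n` product; additions are covered as well, since a product of that shape has
`s * n` entries that each need an instruction (`MatMulCostLE.le`). The exponents then enter by
dropping columns of a rectangular product, or by juxtaposing `m` square ones. -/

theorem StraightLine.subset {Γ : Set (X → F) → Set (X → F) → Prop} {I S : Set (X → F)} {a p : ℕ}
    (h : StraightLine Γ I a p S) : I ∪ {f | ∃ c : F, f = fun _ => c} ⊆ S := by
  induction h with
  | start => exact subset_rfl
  | add _ _ _ ih => exact ih.trans (Set.subset_insert _ _)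
  | sub _ _ _ ih => exact ih.trans (Set.subset_insert _ _)
  | mul _ _ _ ih => exact ih.trans (Set.subset_insert _ _)
  | div _ _ _ _ ih => exact ih.trans (Set.subset_insert _ _)
  | call _ _ ih => exact ih.trans Set.subset_union_left

/-- Available values are never lost, so the second program can be replayed after the first; surplus
values do no harm. -/
theorem StraightLine.append {Γ : Set (X → F) → Set (X → F) → Prop} {I S I' S' : Set (X → F)}
    {a p a' p' : ℕ} (h : StraightLine Γ I a p S)
    (h' : StraightLine (fun _ _ => False) I' a' p' S') (hI : I' ⊆ S) :
    ∃ S'', StraightLine Γ I (a + a') p S'' ∧ S ⊆ S'' ∧ S' ⊆ S'' := by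
  induction h' with
  | start =>
    exact ⟨S, h, subset_rfl, Set.union_subset hI (Set.subset_union_right.trans h.subset)⟩
  | add _ hf hg ih =>
    obtain ⟨T, hT, h1, h2⟩ := ih
    exact ⟨_, hT.add (h2 hf) (h2 hg), h1.trans (Set.subset_insert _ _), Set.insert_subset_insert h2⟩
  | sub _ hf hg ih =>
    obtain ⟨T, hT, h1, h2⟩ := ih
    exact ⟨_, hT.sub (h2 hf) (h2 hg), h1.trans (Set.subset_insert _ _), Set.insert_subset_insert h2⟩
  | mul _ hf hg ih =>
    obtain ⟨T, hT, h1, h2⟩ := ih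
    exact ⟨_, hT.mul (h2 hf) (h2 hg), h1.trans (Set.subset_insert _ _), Set.insert_subset_insert h2⟩
  | div _ hf hg h0 ih =>
    obtain ⟨T, hT, h1, h2⟩ := ih
    exact ⟨_, hT.div (h2 hf) (h2 hg) h0, h1.trans (Set.subset_insert _ _),
      Set.insert_subset_insert h2⟩
  | call _ hT => exact hT.elim

theorem CostLE.mono {I I' O O' : Set (X → F)} {t t' : ℝ} (h : CostLE I O t) (hI : I ⊆ I')
    (hO : O' ⊆ O) (ht : t ≤ t') : CostLE I' O' t' := by
  obtain ⟨a, S, hS, hOS, hat⟩ := h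
  obtain ⟨S', hS', -, h2⟩ := StraightLine.append (StraightLine.start (I := I')) hS
    (hI.trans Set.subset_union_left)
  exact ⟨_, S', by simpa using hS', hO.trans (hOS.trans h2), by simpa using hat.trans ht⟩

theorem CostLE.start (I : Set (X → F)) :
    CostLE I (I ∪ {f | ∃ c : F, f = fun _ => c}) 0 :=
  ⟨0, _, .start, subset_rfl, by simp⟩

theorem CostLE.of_subset {I O : Set (X → F)} (h : O ⊆ I ∪ {f | ∃ c : F, f = fun _ => c}) :
    CostLE I O 0 :=
  (CostLE.start I).mono subset_rfl h le_rfl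

theorem CostLE.append {I O O' : Set (X → F)} {t t' : ℝ} (h : CostLE I O t)
    (h' : CostLE (I ∪ O) O' t') : CostLE I (O ∪ O') (t + t') := by
  obtain ⟨a, S, hS, hOS, hat⟩ := h
  obtain ⟨a', S', hS', hOS', hat'⟩ := h'
  obtain ⟨S'', h1, h2, h3⟩ := hS.append hS'
    (Set.union_subset (Set.subset_union_left.trans hS.subset) hOS)
  exact ⟨_, S'', h1, Set.union_subset (hOS.trans h2) (hOS'.trans h3), by push_cast; linarith⟩

theorem CostLE.add {I : Set (X → F)} {f g : X → F} (hf : f ∈ I) (hg : g ∈ I) :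
    CostLE I {f + g} 1 :=
  ⟨_, _, StraightLine.start.add (Or.inl hf) (Or.inl hg),
    Set.singleton_subset_iff.2 (Set.mem_insert _ _), by simp⟩

theorem CostLE.sub {I : Set (X → F)} {f g : X → F} (hf : f ∈ I) (hg : g ∈ I) :
    CostLE I {f - g} 1 :=
  ⟨_, _, StraightLine.start.sub (Or.inl hf) (Or.inl hg),
    Set.singleton_subset_iff.2 (Set.mem_insert _ _), by simp⟩

theorem CostLE.smul {I : Set (X → F)} (c : F) {f : X → F} (hf : f ∈ I) :
    CostLE I {c • f} 1 :=
  ⟨_, _, StraightLine.start.mul (Or.inr ⟨c, rfl⟩) (Or.inl hf),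
    Set.singleton_subset_iff.2 (Set.mem_insert _ _), by simp⟩

theorem CostLE.iUnion_finset {ι : Type*} {I : Set (X → F)} {O : ι → Set (X → F)} {t : ℝ}
    (s : Finset ι) (h : ∀ i ∈ s, CostLE I (O i) t) : CostLE I (⋃ i ∈ s, O i) (s.card * t) := by
  classical
  induction s using Finset.induction_on with
  | empty => exact (CostLE.start I).mono subset_rfl (by simp) (by simp)
  | insert i s hi ih =>
    refine ((h i (by simp)).append ((ih fun j hj => h j (by simp [hj])).mono
      Set.subset_union_left subset_rfl le_rfl)).mono subset_rfl ?_ ?_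
    · simp
    · rw [Finset.card_insert_of_notMem hi]; push_cast; linarith

theorem CostLE.iUnion {ι : Type*} [Fintype ι] {I : Set (X → F)} {O : ι → Set (X → F)} {t : ℝ}
    (h : ∀ i, CostLE I (O i) t) : CostLE I (⋃ i, O i) (Fintype.card ι * t) := by
  simpa using CostLE.iUnion_finset Finset.univ fun i _ => h i

/-- Substitution into the inputs. They may become constants, which is what padding a matrix by zeros
requires. -/
theorem StraightLine.comap {Y : Type*} (φ : Y → X) {I S : Set (X → F)} {a p : ℕ}
    (h : StraightLine (fun _ _ => False) I a p S) {I' : Set (Y → F)}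
    (hI : ∀ f ∈ I, f ∘ φ ∈ I' ∪ {f | ∃ c : F, f = fun _ => c}) :
    ∃ S', StraightLine (fun _ _ => False) I' a p S' ∧ ∀ f ∈ S, f ∘ φ ∈ S' := by
  induction h with
  | start =>
    refine ⟨_, .start, ?_⟩
    rintro f (hf | ⟨c, rfl⟩)
    · exact hI f hf
    · exact Or.inr ⟨c, rfl⟩
  | add _ hf hg ih =>
    obtain ⟨T, hT, h2⟩ := ih
    refine ⟨_, hT.add (h2 _ hf) (h2 _ hg), ?_⟩
    rintro f (rfl | hf')
    · exact Set.mem_insert _ _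
    · exact Set.mem_insert_of_mem _ (h2 _ hf')
  | sub _ hf hg ih =>
    obtain ⟨T, hT, h2⟩ := ih
    refine ⟨_, hT.sub (h2 _ hf) (h2 _ hg), ?_⟩
    rintro f (rfl | hf')
    · exact Set.mem_insert _ _
    · exact Set.mem_insert_of_mem _ (h2 _ hf')
  | mul _ hf hg ih =>
    obtain ⟨T, hT, h2⟩ := ih
    refine ⟨_, hT.mul (h2 _ hf) (h2 _ hg), ?_⟩
    rintro f (rfl | hf')
    · exact Set.mem_insert _ _
    · exact Set.mem_insert_of_mem _ (h2 _ hf')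
  | div _ hf hg h0 ih =>
    obtain ⟨T, hT, h2⟩ := ih
    refine ⟨_, hT.div (h2 _ hf) (h2 _ hg) fun y => h0 (φ y), ?_⟩
    rintro f (rfl | hf')
    · exact Set.mem_insert _ _
    · exact Set.mem_insert_of_mem _ (h2 _ hf')
  | call _ hT => exact hT.elim

theorem CostLE.comap {Y : Type*} (φ : Y → X) {I O : Set (X → F)} {t : ℝ} (h : CostLE I O t)
    {I' O' : Set (Y → F)} (hI : ∀ f ∈ I, f ∘ φ ∈ I' ∪ {f | ∃ c : F, f = fun _ => c})
    (hO : ∀ g ∈ O', ∃ f ∈ O, g = f ∘ φ) : CostLE I' O' t := by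
  obtain ⟨a, S, hS, hOS, hat⟩ := h
  obtain ⟨S', hS', h2⟩ := hS.comap φ hI
  refine ⟨a, S', hS', fun g hg => ?_, hat⟩
  obtain ⟨f, hf, rfl⟩ := hO g hg
  exact h2 f (hOS hf)

/-- Calls of a subroutine may be replaced by programs for it. -/
theorem StraightLine.costLE {Γ : Set (X → F) → Set (X → F) → Prop} {t : ℝ}
    (hΓ : ∀ S T, Γ S T → CostLE S T t) {I S : Set (X → F)} {a p : ℕ}
    (h : StraightLine Γ I a p S) : CostLE I S (a + p * t) := by
  induction h with
  | start => simpa using CostLE.start I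
  | add _ hf hg ih =>
    refine (ih.append ((CostLE.add hf hg).mono Set.subset_union_right subset_rfl le_rfl)).mono
      subset_rfl (Set.insert_subset (Or.inr rfl) Set.subset_union_left) (by push_cast; linarith)
  | sub _ hf hg ih =>
    refine (ih.append ((CostLE.sub hf hg).mono Set.subset_union_right subset_rfl le_rfl)).mono
      subset_rfl (Set.insert_subset (Or.inr rfl) Set.subset_union_left) (by push_cast; linarith)
  | mul _ hf hg ih =>
    obtain ⟨b, S', h1, h2, h3⟩ := ih
    exact ⟨_, _, h1.mul (h2 hf) (h2 hg), Set.insert_subset_insert h2, by push_cast; linarith⟩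
  | div _ hf hg h0 ih =>
    obtain ⟨b, S', h1, h2, h3⟩ := ih
    exact ⟨_, _, h1.div (h2 hf) (h2 hg) h0, Set.insert_subset_insert h2, by push_cast; linarith⟩
  | call _ hT ih =>
    exact (ih.append ((hΓ _ _ hT).mono Set.subset_union_right subset_rfl le_rfl)).mono
      subset_rfl subset_rfl (by push_cast; linarith)

theorem StraightLine.exists_finset {I S : Set (X → F)} {a p : ℕ}
    (h : StraightLine (fun _ _ => False) I a p S) :
    ∃ t : Finset (X → F), t.card ≤ a ∧ S ⊆ I ∪ {f | ∃ c : F, f = fun _ => c} ∪ t := by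
  classical
  have key : ∀ {b : ℕ} {T : Set (X → F)} (f : X → F),
      (∃ t : Finset (X → F), t.card ≤ b ∧ T ⊆ I ∪ {f | ∃ c : F, f = fun _ => c} ∪ t) →
      ∃ t : Finset (X → F), t.card ≤ b + 1 ∧
        insert f T ⊆ I ∪ {f | ∃ c : F, f = fun _ => c} ∪ t := by
    rintro b T f ⟨t, ht, hT⟩
    refine ⟨insert f t, (Finset.card_insert_le _ _).trans (by omega), ?_⟩
    rw [Finset.coe_insert]
    refine Set.insert_subset (Or.inr (Set.mem_insert _ _)) (hT.trans ?_)
    exact Set.union_subset_union_right _ (Set.subset_insert _ _)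
  induction h with
  | start => exact ⟨∅, by simp, by simp⟩
  | add _ _ _ ih => exact key _ ih
  | sub _ _ _ ih => exact key _ ih
  | mul _ _ _ ih => exact key _ ih
  | div _ _ _ _ ih => exact key _ ih
  | call _ hT => exact hT.elim

/-- Every entry of a matrix product has to be computed. -/
theorem MatMulCostLE.le {a b c : ℕ} {t : ℝ} (hb : 0 < b) (h : MatMulCostLE F a b c t) :
    (a : ℝ) * c ≤ t := by
  classical
  obtain ⟨k, S, hS, hO, hk⟩ := h
  obtain ⟨u, hu, hSu⟩ := hS.exists_finset
  let o : Fin b := ⟨0, hb⟩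
  let f : Fin a × Fin c → (Matrix (Fin a) (Fin b) F × Matrix (Fin b) (Fin c) F → F) :=
    fun ij x => (x.1 * x.2) ij.1 ij.2
  -- Pairs of matrix units separate the entries of the product from each other.
  have hf : ∀ ij i j, f ij (Matrix.single i o 1, Matrix.single o j 1)
      = if ij = (i, j) then 1 else 0 := by
    rintro ⟨i', j'⟩ i j
    simp [f, Matrix.single_apply, eq_comm]
  have hinj : Function.Injective f := by
    rintro ⟨i, j⟩ ij' h
    by_contra hne
    have h1 := hf (i, j) i j
    rw [h, hf ij' i j] at h1
    simp [Ne.symm hne] at h1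
  have hmem : ∀ ij, f ij ∈ u := by
    rintro ⟨i, j⟩
    have h1 : f (i, j) (Matrix.single i o 1, Matrix.single o j 1) = 1 := by simp [hf]
    -- An input entry depends on one factor only and a constant on none, whereas `f (i, j)` drops
    -- from 1 to 0 when the other factor is replaced by 0; so it has to be one of the computed
    -- values.
    rcases hSu (hO ⟨i, j, rfl⟩ : f (i, j) ∈ S) with ((⟨k, l, h⟩ | ⟨k, l, h⟩) | ⟨c, h⟩) | h
    · have h2 : f (i, j) (Matrix.single i o 1, 0) = 0 := by simp [f]
      rw [h] at h1 h2
      exact absurd (h1.symm.trans h2) one_ne_zero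
    · have h2 : f (i, j) (0, Matrix.single o j 1) = 0 := by simp [f]
      rw [h] at h1 h2
      exact absurd (h1.symm.trans h2) one_ne_zero
    · have h2 : f (i, j) (0, 0) = 0 := by simp [f]
      rw [h] at h1 h2
      exact absurd (h1.symm.trans h2) one_ne_zero
    · exact h
  have hc : a * c ≤ u.card := by
    have h1 := Finset.card_le_card_of_injOn (s := Finset.univ) (t := u) f (fun ij _ => hmem ij)
      hinj.injOn
    simpa using h1
  have : ((a * c : ℕ) : ℝ) ≤ k := by exact_mod_cast hc.trans hu
  push_cast at this
  linarith

end Programs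

/-! ### Fast convolution -/

section CostModel

variable {F E : Type*} [Field F] [AddCommGroup E] [Module F E]

/-- `K I O a` behaves like "`O` can be computed from `I` with `a` operations", where zero is
available for free, and additions, subtractions, multiplications by constants and evaluations
of the bilinear map `β` count as one operation. -/
structure IsCostModel (β : E →ₗ[F] E →ₗ[F] E) (K : Set E → Set E → ℕ → Prop) : Prop where
  mono : ∀ {I I' O O' a a'}, K I O a → I ⊆ I' → O' ⊆ O → a ≤ a' → K I' O' a'
  start : ∀ I, K I (insert 0 I) 0
  append : ∀ {I O O' a b}, K I O a → K (I ∪ O) O' b → K I (O ∪ O') (a + b)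
  add : ∀ x y, K {x, y} {x + y} 1
  sub : ∀ x y, K {x, y} {x - y} 1
  smul : ∀ (c : F) x, K {x} {c • x} 1
  mul : ∀ x y, K {x, y} {β x y} 1

namespace IsCostModel

variable {β : E →ₗ[F] E →ₗ[F] E} {K : Set E → Set E → ℕ → Prop} (hK : IsCostModel β K)
include hK

theorem comp {I O O' : Set E} {a b : ℕ} (h : K I O a) (h' : K O O' b) : K I O' (a + b) :=
  hK.mono (hK.append h (hK.mono h' Set.subset_union_right subset_rfl le_rfl)) subset_rfl
    Set.subset_union_right le_rfl

theorem union {I O O' : Set E} {a b : ℕ} (h : K I O a) (h' : K I O' b) : K I (O ∪ O') (a + b) :=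
  hK.append h (hK.mono h' Set.subset_union_left subset_rfl le_rfl)

theorem of_subset {I O : Set E} (h : O ⊆ I) : K I O 0 :=
  hK.mono (hK.start I) subset_rfl (h.trans (Set.subset_insert _ _)) le_rfl

theorem iUnion {ι : Type*} {I : Set E} {O : ι → Set E} {a : ℕ} (s : Finset ι)
    (h : ∀ i ∈ s, K I (O i) a) : K I (⋃ i ∈ s, O i) (s.card * a) := by
  classical
  induction s using Finset.induction_on with
  | empty => exact hK.mono (hK.start I) subset_rfl (by simp) (by simp)
  | insert i s hi ih =>
    refine hK.mono (hK.union (h i (by simp)) (ih fun j hj => h j (by simp [hj]))) subset_rfl ?_ ?_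
    · simp
    · rw [Finset.card_insert_of_notMem hi]; linarith

theorem image {ι : Type*} {I : Set E} {f : ι → E} {a : ℕ} (s : Finset ι)
    (h : ∀ i ∈ s, K I {f i} a) : K I {e | ∃ i ∈ s, e = f i} (s.card * a) := by
  refine hK.mono (hK.iUnion s h) subset_rfl ?_ le_rfl
  rintro _ ⟨i, hi, rfl⟩
  simp only [Set.mem_iUnion]
  exact ⟨i, hi, rfl⟩

theorem sum {ι : Type*} {I : Set E} {f : ι → E} (s : Finset ι) (h : ∀ i ∈ s, f i ∈ I) :
    K I {∑ i ∈ s, f i} s.card := by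
  classical
  induction s using Finset.induction_on with
  | empty => exact hK.mono (hK.start I) subset_rfl (by simp) (by simp)
  | insert i s hi ih =>
    rw [Finset.sum_insert hi, Finset.card_insert_of_notMem hi]
    refine hK.mono (hK.append (ih fun j hj => h j (by simp [hj]))
      (hK.mono (hK.add (f i) (∑ i ∈ s, f i)) ?_ subset_rfl le_rfl)) subset_rfl
      Set.subset_union_right le_rfl
    rintro _ (rfl | rfl)
    · exact Or.inl (h i (by simp))
    · exact Or.inr rfl

end IsCostModel

end CostModel

/-! ### Fourier transforms and cyclic convolutions over a cyclic group algebra. -/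

section Convolution

theorem sum_range_mul {M : Type*} [AddCommMonoid M] (f : ℕ → M) (a b : ℕ) :
    ∑ k ∈ Finset.range (a * b), f k
      = ∑ j ∈ Finset.range a, ∑ r ∈ Finset.range b, f (j * b + r) := by
  induction a with
  | zero => simp
  | succ a ih => rw [Nat.succ_mul, Finset.sum_range_add, ih, Finset.sum_range_succ]

theorem ZMod.sum_eq_sum_range {M : Type*} [AddCommMonoid M] {n : ℕ} [NeZero n] (f : ZMod n → M) :
    ∑ x, f x = ∑ k ∈ Finset.range n, f (k : ZMod n) := by
  refine Finset.sum_bij' (fun x _ => x.val) (fun k _ => (k : ZMod n)) ?_ ?_ ?_ ?_ ?_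
  · intro x _; simpa using ZMod.val_lt x
  · simp
  · intro x _; simp
  · intro k hk; exact ZMod.val_cast_of_lt (by simpa using hk)
  · intro x _; simp

variable {F E : Type*} [Field F] [AddCommGroup E] [Module F E]

/-- The discrete Fourier transform of length `p ^ l` over the group algebra of `ZMod D`. -/
theorem IsCostModel.fft {β : E →ₗ[F] E →ₗ[F] E} {K : Set E → Set E → ℕ → Prop}
    (hK : IsCostModel β K) {D : ℕ} [NeZero D] {p : ℕ} (hp : 0 < p) :
    ∀ (l : ℕ) (ω : ZMod D), p ^ l • ω = 0 → ∀ a : ℕ → ZMod D → E,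
      K {e | ∃ j < p ^ l, ∃ d, e = a j d}
        {e | ∃ (i : ℕ) (d : ZMod D), e = ∑ j ∈ Finset.range (p ^ l), a j (d - (i * j) • ω)}
        (l * p ^ l * D * p) := by
  intro l
  induction l with
  | zero =>
    intro ω _ a
    refine hK.mono (hK.of_subset ?_) subset_rfl subset_rfl (Nat.zero_le _)
    rintro _ ⟨i, d, rfl⟩
    exact ⟨0, by simp, d, by simp⟩
  | succ l ih =>
    intro ω hω a
    have hω' : p ^ l • (p • ω) = 0 := by rw [← mul_smul, ← pow_succ]; exact hω
    have h1 := hK.iUnion (I := {e | ∃ j < p ^ (l + 1), ∃ d, e = a j d}) (Finset.range p)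
      fun r hr => hK.mono (ih (p • ω) hω' fun j => a (j * p + r)) (by
        rintro _ ⟨j, hj, d, rfl⟩
        refine ⟨j * p + r, ?_, d, rfl⟩
        have := Finset.mem_range.1 hr
        calc j * p + r < j * p + p := by omega
          _ = (j + 1) * p := by ring
          _ ≤ p ^ l * p := Nat.mul_le_mul_right _ hj
          _ = p ^ (l + 1) := (pow_succ _ _).symm) subset_rfl le_rfl
    refine hK.mono (hK.comp h1 (hK.image (a := p)
      (f := fun x : ℕ × ZMod D => ∑ j ∈ Finset.range (p ^ (l + 1)), a j (x.2 - (x.1 * j) • ω))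
      (Finset.range (p ^ (l + 1)) ×ˢ Finset.univ) ?_)) subset_rfl ?_ ?_
    · rintro ⟨i, d⟩ -
      -- Radix-`p` splitting by the residue of the index modulo `p`. The twiddle factors are shifts
      -- of `d`, hence free, and each output is a sum of `p` available elements.
      have : ∑ j ∈ Finset.range (p ^ (l + 1)), a j (d - (i * j) • ω)
          = ∑ r ∈ Finset.range p, ∑ j ∈ Finset.range (p ^ l),
              a (j * p + r) ((d - (i * r) • ω) - (i * j) • (p • ω)) := by
        rw [pow_succ, sum_range_mul, Finset.sum_comm]
        refine Finset.sum_congr rfl fun r _ => Finset.sum_congr rfl fun j _ => ?_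
        congr 1
        simp only [nsmul_eq_mul]
        push_cast
        ring
      simp only [this]
      refine hK.mono (hK.sum (Finset.range p) ?_) subset_rfl subset_rfl (by simp)
      intro r hr
      simp only [Set.mem_iUnion]
      exact ⟨r, hr, i, _, rfl⟩
    -- The outputs are periodic in `i`, so only `p ^ (l + 1)` of them have to be computed.
    · rintro _ ⟨i, d, rfl⟩
      have hpos : 0 < p ^ (l + 1) := pow_pos hp _
      refine ⟨(i % p ^ (l + 1), d), by simpa using Nat.mod_lt _ hpos, ?_⟩
      refine Finset.sum_congr rfl fun j _ => ?_
      congr 2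
      conv_lhs => rw [← Nat.mod_add_div i (p ^ (l + 1))]
      rw [add_mul, add_smul, mul_assoc, mul_comm, mul_smul, smul_comm, mul_comm, mul_smul, hω]
      simp
    · simp only [Finset.card_range, Finset.card_product, Finset.card_univ, ZMod.card]
      apply le_of_eq
      ring

/-- The cyclic convolution of two sequences. -/
def cyclicConv (β : E →ₗ[F] E →ₗ[F] E) {N : ℕ} [NeZero N] (f g : ZMod N → E) (d : ZMod N) : E :=
  ∑ e, β (f e) (g (d - e))

variable (β : E →ₗ[F] E →ₗ[F] E)

theorem cyclicConv_shift {N : ℕ} [NeZero N] (f g : ZMod N → E) (a b d : ZMod N) :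
    cyclicConv β (fun x => f (x - a)) (fun x => g (x - b)) d = cyclicConv β f g (d - a - b) := by
  unfold cyclicConv
  rw [← Equiv.sum_comp (Equiv.addRight a)]
  refine Finset.sum_congr rfl fun e _ => ?_
  simp only [Equiv.coe_addRight, add_sub_cancel_right]
  congr 2
  ring

theorem cyclicConv_sum {N : ℕ} [NeZero N] {ι κ : Type*} (s : Finset ι) (t : Finset κ)
    (f : ι → ZMod N → E) (g : κ → ZMod N → E) (d : ZMod N) :
    cyclicConv β (fun x => ∑ i ∈ s, f i x) (fun x => ∑ j ∈ t, g j x) d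
      = ∑ i ∈ s, ∑ j ∈ t, cyclicConv β (f i) (g j) d := by
  unfold cyclicConv
  have h : ∀ e, β (∑ i ∈ s, f i e) (∑ j ∈ t, g j (d - e))
      = ∑ i ∈ s, ∑ j ∈ t, β (f i e) (g j (d - e)) := by
    intro e
    simp only [map_sum, LinearMap.sum_apply]
    exact Finset.sum_comm
  simp only [h]
  rw [Finset.sum_comm]
  exact Finset.sum_congr rfl fun i _ => Finset.sum_comm

/-- The convolution theorem, where a vector and its shift by `π` have to be compared because the
powers of the root of unity sum up to zero only modulo elements fixed by this shift. -/
theorem cyclicConv_dft {J D : ℕ} [NeZero J] [NeZero D] (φ : ZMod J →+ ZMod D) (π : ZMod D)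
    (hπ : ∀ s : ZMod J, s ≠ 0 → ∃ i, φ (i * s) = π) (a b : ZMod J → ZMod D → E)
    (T : ZMod J → ZMod D → E)
    (hT : ∀ t x, T t x = ∑ i, cyclicConv β (fun y => ∑ j, a j (y - φ (i * j)))
      (fun y => ∑ j, b j (y - φ (i * j))) (x + φ (i * t)))
    (t : ZMod J) (x : ZMod D) :
    T t x - T t (x - π) = J • (∑ j, cyclicConv β (a j) (b (t - j)) x
      - ∑ j, cyclicConv β (a j) (b (t - j)) (x - π)) := by
  have h1 : ∀ x, T t x = ∑ j, ∑ s, ∑ i, cyclicConv β (a j) (b (s + (t - j))) (x - φ (i * s)) := by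
    intro x
    rw [hT]
    simp only [cyclicConv_sum, cyclicConv_shift]
    rw [Finset.sum_comm]
    refine Finset.sum_congr rfl fun j _ => ?_
    rw [Finset.sum_comm, ← Equiv.sum_comp (Equiv.addRight (t - j))]
    refine Finset.sum_congr rfl fun s _ => Finset.sum_congr rfl fun i _ => ?_
    simp only [Equiv.coe_addRight]
    congr 1
    have : i * (s + (t - j)) = i * s + i * t - i * j := by ring
    rw [this, map_sub, map_add]
    abel
  -- The term `s = 0` yields `J` copies of the wanted value. For `s ≠ 0`, translating `i` by `i₀`
  -- shows that the inner sum is invariant under the shift by `π`, so it cancels.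
  have h2 : ∀ j, ∑ s, ∑ i, cyclicConv β (a j) (b (s + (t - j))) (x - φ (i * s))
      - ∑ s, ∑ i, cyclicConv β (a j) (b (s + (t - j))) (x - π - φ (i * s))
      = J • (cyclicConv β (a j) (b (t - j)) x - cyclicConv β (a j) (b (t - j)) (x - π)) := by
    intro j
    rw [← Finset.sum_sub_distrib, Finset.sum_eq_single 0]
    · simp [ZMod.card, smul_sub]
    · intro s _ hs
      obtain ⟨i₀, hi₀⟩ := hπ s hs
      rw [sub_eq_zero, ← Equiv.sum_comp (Equiv.addRight i₀)]
      refine Finset.sum_congr rfl fun i _ => ?_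
      simp only [Equiv.coe_addRight, add_mul, map_add, hi₀]
      congr 1
      abel
    · simp
  rw [h1, h1, ← Finset.sum_sub_distrib, ← Finset.sum_sub_distrib, Finset.smul_sum]
  exact Finset.sum_congr rfl fun j _ => h2 j

end Convolution

/-! ### Quasi-linear cyclic convolution by chunking and recursion. -/

section FastConvolution

theorem ZMod.exists_addMonoidHom {J N B : ℕ} (h : N ∣ J * B) :
    ∃ ψ : ZMod J →+ ZMod N, ∀ n : ℕ, ψ n = ((n * B : ℕ) : ZMod N) := by
  refine ⟨ZMod.lift J ⟨zmultiplesHom _ (B : ZMod N), ?_⟩, fun n => ?_⟩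
  · simpa using (ZMod.natCast_eq_zero_iff (J * B) N).2 h
  · have := ZMod.lift_coe J (⟨zmultiplesHom _ (B : ZMod N),
      by simpa using (ZMod.natCast_eq_zero_iff (J * B) N).2 h⟩ :
        { f : ℤ →+ ZMod N // f J = 0 }) (n : ℤ)
    simpa using this

/-- Multiplication by `p ^ (k - l)` embeds one cyclic `p`-group in the other. The multiples of a
nonzero `s` contain the subgroup of order `p`, because the gcd of `s` and `p ^ l` is `p ^ a` with `a
< l`. One `π` thus serves all `s` in `cyclicConv_dft`. -/
theorem ZMod.exists_root_of_unity {p l k : ℕ} (hp : p.Prime) (hlk : l ≤ k) :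
    ∃ φ : ZMod (p ^ l) →+ ZMod (p ^ k),
      ∀ s : ZMod (p ^ l), s ≠ 0 → ∃ i, φ (i * s) = ((p ^ (k - 1) : ℕ) : ZMod (p ^ k)) := by
  have hk : p ^ l * p ^ (k - l) = p ^ k := by rw [← pow_add]; congr 1; omega
  obtain ⟨φ, hφ⟩ := ZMod.exists_addMonoidHom (J := p ^ l) (N := p ^ k) (B := p ^ (k - l))
    (by rw [hk])
  have : NeZero (p ^ l) := ⟨pow_ne_zero _ hp.ne_zero⟩
  refine ⟨φ, fun s hs => ?_⟩
  obtain ⟨a, ha, hgcd⟩ := (Nat.dvd_prime_pow hp).1 (Nat.gcd_dvd_right s.val (p ^ l))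
  have hal : a < l := by
    refine lt_of_le_of_ne ha fun h => hs ?_
    have h1 : p ^ l ∣ s.val := by
      refine dvd_trans ?_ (Nat.gcd_dvd_left s.val (p ^ l))
      rw [hgcd]
      exact pow_dvd_pow p h.ge
    rw [← ZMod.natCast_zmod_val s]
    exact (ZMod.natCast_eq_zero_iff _ _).2 h1
  have h1 : ((p ^ a : ℕ) : ZMod (p ^ l)) = s * ((Nat.gcdA s.val (p ^ l) : ℤ) : ZMod (p ^ l)) := by
    have := congrArg (Int.cast : ℤ → ZMod (p ^ l)) (Nat.gcd_eq_gcd_ab s.val (p ^ l))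
    rw [hgcd] at this
    push_cast at this
    rw [ZMod.natCast_zmod_val] at this
    have h0 : ((p : ZMod (p ^ l)) ^ l) = 0 := by
      exact_mod_cast ZMod.natCast_self (p ^ l)
    rw [h0, zero_mul, add_zero] at this
    exact_mod_cast this
  refine ⟨((p ^ (l - 1 - a) : ℕ) : ZMod (p ^ l)) *
    ((Nat.gcdA s.val (p ^ l) : ℤ) : ZMod (p ^ l)), ?_⟩
  have h2 : ((p ^ (l - 1 - a) : ℕ) : ZMod (p ^ l)) *
      ((Nat.gcdA s.val (p ^ l) : ℤ) : ZMod (p ^ l)) * s = ((p ^ (l - 1) : ℕ) : ZMod (p ^ l)) := by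
    rw [mul_assoc, mul_comm _ s, ← h1, ← Nat.cast_mul, ← pow_add]
    congr 3
    omega
  rw [h2, hφ, ← pow_add]
  congr 3
  omega

variable {F E : Type*} [Field F] [AddCommGroup E] [Module F E]

theorem IsCostModel.dft {β : E →ₗ[F] E →ₗ[F] E} {K : Set E → Set E → ℕ → Prop}
    (hK : IsCostModel β K) {D p l : ℕ} [NeZero D] [NeZero (p ^ l)] (hp : 0 < p)
    (φ : ZMod (p ^ l) →+ ZMod D) (a : ZMod (p ^ l) → ZMod D → E) :
    K {e | ∃ j d, e = a j d}
      {e | ∃ (i : ZMod (p ^ l)) (d : ZMod D), e = ∑ j, a j (d - φ (i * j))}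
      (l * p ^ l * D * p) := by
  have hφ : ∀ n : ℕ, φ n = n • φ 1 := fun n => by rw [← map_nsmul]; simp
  refine hK.mono (hK.fft hp l (φ 1) ?_ fun j => a j) ?_ ?_ le_rfl
  · rw [← hφ]; simp
  · rintro _ ⟨j, -, d, rfl⟩
    exact ⟨_, _, rfl⟩
  · rintro _ ⟨i, d, rfl⟩
    refine ⟨i.val, d, ?_⟩
    rw [ZMod.sum_eq_sum_range]
    refine Finset.sum_congr rfl fun j _ => ?_
    rw [← hφ]
    simp

variable (β : E →ₗ[F] E →ₗ[F] E)

/-- The `j`-th chunk of `f`, as a polynomial of degree less than `B`. -/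
def chunk {J N : ℕ} (D B : ℕ) (ψ : ZMod J →+ ZMod N) (f : ZMod N → E) (j : ZMod J)
    (x : ZMod D) : E :=
  if x.val < B then f (ψ j + (x.val : ZMod N)) else 0

/-- Two supports of length `B` add up to one of length `2 * B`; the empty room above it separates a
product from its copy shifted by `π`. -/
theorem cyclicConv_chunk_eq_zero {J N B D : ℕ} [NeZero D] (ψ : ZMod J →+ ZMod N)
    (f g : ZMod N → E) (j j' : ZMod J) (x : ZMod D) (hx : 2 * B ≤ x.val) :
    cyclicConv β (chunk D B ψ f j) (chunk D B ψ g j') x = 0 := by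
  refine Finset.sum_eq_zero fun e _ => ?_
  unfold chunk
  split_ifs with h1 h2
  · have := ZMod.val_add_le e (x - e)
    rw [add_sub_cancel] at this
    omega
  all_goals simp

theorem cyclicConv_chunk_apply {J N B D : ℕ} [NeZero D] (hBD : B ≤ D)
    (ψ : ZMod J →+ ZMod N) (f : ZMod N → E) (g : ZMod D → E) (j : ZMod J) (x : ZMod D) :
    cyclicConv β (chunk D B ψ f j) g x
      = ∑ e ∈ Finset.range B, β (f (ψ j + (e : ZMod N))) (g (x - e)) := by
  unfold cyclicConv
  rw [ZMod.sum_eq_sum_range]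
  symm
  refine Finset.sum_subset_zero_on_sdiff (by simpa using hBD) ?_ ?_
  · intro e he
    simp only [Finset.mem_sdiff, Finset.mem_range, not_lt] at he
    simp [chunk, ZMod.val_cast_of_lt he.1, not_lt.2 he.2]
  · intro e he
    have he := Finset.mem_range.1 he
    simp [chunk, ZMod.val_cast_of_lt (he.trans_le hBD), he]

/-- If `e ≤ d`, the index stays in chunk `t`; otherwise it borrows from chunk `t - 1`. As `2 * B ≤
D`, the other summand is read outside its support and vanishes. -/
theorem chunk_add_chunk {J N B D : ℕ} [NeZero D] (hD : 2 * B ≤ D)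
    (ψ : ZMod J →+ ZMod N) (hψ : ∀ n : ℕ, ψ n = ((n * B : ℕ) : ZMod N)) (g : ZMod N → E)
    (t : ZMod J) {d e : ℕ} (hd : d < B) (he : e < B) :
    g (ψ t + d - e) = chunk D B ψ g t ((d : ZMod D) - e)
      + chunk D B ψ g (t - 1) (((d + B : ℕ) : ZMod D) - e) := by
  have hval : ∀ n < D, ((n : ℕ) : ZMod D).val = n := fun n hn => ZMod.val_cast_of_lt hn
  unfold chunk
  rcases le_or_gt e d with h | h
  · rw [← Nat.cast_sub h, ← Nat.cast_sub (by omega : e ≤ d + B), hval _ (by omega),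
      hval _ (by omega), if_pos (by omega), if_neg (by omega), add_zero, Nat.cast_sub h]
    congr 1
    abel
  · have h1 : (d : ZMod D) - e = ((d + D - e : ℕ) : ZMod D) := by
      rw [Nat.cast_sub (by omega)]
      simp
    have h2 : ψ 1 = (B : ZMod N) := by simpa using hψ 1
    rw [h1, ← Nat.cast_sub (by omega : e ≤ d + B), hval _ (by omega),
      hval _ (by omega), if_neg (by omega), if_pos (by omega), zero_add,
      Nat.cast_sub (by omega), map_sub, h2]
    congr 1
    push_cast
    abel

/-- Products of chunks have double length, so position `d` of chunk `t` also receives the overflow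
at `d + B` from chunk `t - 1`. -/
theorem cyclicConv_eq_chunk {J N B D : ℕ} [NeZero D] [NeZero J] [NeZero N] (hN : N = J * B)
    (hD : 2 * B ≤ D) (ψ : ZMod J →+ ZMod N) (hψ : ∀ n : ℕ, ψ n = ((n * B : ℕ) : ZMod N))
    (f g : ZMod N → E) (t : ZMod J) {d : ℕ} (hd : d < B) :
    cyclicConv β f g (ψ t + d)
      = ∑ j, cyclicConv β (chunk D B ψ f j) (chunk D B ψ g (t - j)) (d : ZMod D)
        + ∑ j, cyclicConv β (chunk D B ψ f j) (chunk D B ψ g (t - 1 - j))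
            ((d + B : ℕ) : ZMod D) := by
  have h1 : cyclicConv β f g (ψ t + d) = ∑ j : ZMod J, ∑ e ∈ Finset.range B,
      β (f (ψ j + e)) (g (ψ (t - j) + d - e)) := by
    unfold cyclicConv
    rw [ZMod.sum_eq_sum_range, ZMod.sum_eq_sum_range,
      show Finset.range N = Finset.range (J * B) by rw [hN], sum_range_mul]
    refine Finset.sum_congr rfl fun j _ => Finset.sum_congr rfl fun e _ => ?_
    rw [hψ, map_sub, hψ]
    push_cast
    congr 2
    ring
  rw [h1, ← Finset.sum_add_distrib]
  refine Finset.sum_congr rfl fun j _ => ?_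
  rw [sub_right_comm t 1 j, cyclicConv_chunk_apply β (by omega),
    cyclicConv_chunk_apply β (by omega),
    ← Finset.sum_add_distrib]
  refine Finset.sum_congr rfl fun e he => ?_
  rw [chunk_add_chunk hD ψ hψ g (t - j) hd (Finset.mem_range.1 he), map_add]

theorem ZMod.le_val_sub {B D π : ℕ} [NeZero D] (h1 : 2 * B ≤ π) (h2 : 2 * π ≤ D) (x : ZMod D)
    (hx : x.val < 2 * B) : 2 * B ≤ (x - (π : ZMod D)).val := by
  by_contra! h
  have hD : 0 < D := Nat.pos_of_neZero D
  have hπ : (π : ZMod D).val = π := ZMod.val_cast_of_lt (by omega)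
  have h3 := ZMod.val_add_of_lt (a := x - (π : ZMod D)) (b := (π : ZMod D)) (by omega)
  rw [sub_add_cancel] at h3
  omega

variable {β}

/-- One level of the recursion: two forward transforms of the chunks, `p ^ l` convolutions of length
`D`, an inverse transform, the difference with the shift by `π`, division by `p ^ l`, and the
addition of overflows. -/
theorem IsCostModel.cyclicConv_step {K : Set E → Set E → ℕ → Prop} (hK : IsCostModel β K)
    {p l N B D π c : ℕ} [NeZero D] [NeZero (p ^ l)] [NeZero N] (hp : (p : F) ≠ 0)
    (hN : N = p ^ l * B) (hB : 2 * B ≤ π) (hD : 2 * π ≤ D) (φ : ZMod (p ^ l) →+ ZMod D)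
    (hφ : ∀ s : ZMod (p ^ l), s ≠ 0 → ∃ i, φ (i * s) = (π : ZMod D))
    (hc : ∀ f g : ZMod D → E, K (Set.range f ∪ Set.range g) (Set.range (cyclicConv β f g)) c)
    (f g : ZMod N → E) :
    K (Set.range f ∪ Set.range g) (Set.range (cyclicConv β f g))
      (3 * (l * p ^ l * D * p) + p ^ l * c + 2 * (p ^ l * D) + N) := by
  have hp0 : 0 < p := Nat.pos_of_ne_zero (by rintro rfl; simp at hp)
  obtain ⟨ψ, hψ⟩ := ZMod.exists_addMonoidHom (J := p ^ l) (N := N) (B := B) (by rw [hN])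
  set a := chunk D B ψ f with ha
  set b := chunk D B ψ g with hb
  set a' : ZMod (p ^ l) → ZMod D → E := fun i x => ∑ j, a j (x - φ (i * j)) with ha'
  set b' : ZMod (p ^ l) → ZMod D → E := fun i x => ∑ j, b j (x - φ (i * j)) with hb'
  set P : ZMod (p ^ l) → ZMod D → E := fun i => cyclicConv β (a' i) (b' i) with hP
  -- Written with `-φ`, the inverse transform is another instance of `IsCostModel.dft`.
  set T : ZMod (p ^ l) → ZMod D → E := fun t x => ∑ i, P i (x - (-φ) (t * i)) with hT
  set U : ZMod (p ^ l) → ZMod D → E := fun t x => T t x - T t (x - π) with hU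
  set V : ZMod (p ^ l) → ZMod D → E := fun t x => ((p ^ l : ℕ) : F)⁻¹ • U t x with hV
  have chunk_mem : ∀ h : ZMod N → E,
      {e | ∃ j d, e = chunk D B ψ h j d} ⊆ insert 0 (Set.range h) := by
    rintro h _ ⟨j, d, rfl⟩
    unfold chunk
    split_ifs
    · exact Or.inr ⟨_, rfl⟩
    · exact Or.inl rfl
  have hA : K (Set.range f ∪ Set.range g) {e | ∃ i x, e = a' i x} (l * p ^ l * D * p) := by
    have := hK.comp (hK.mono (hK.start (Set.range f)) subset_rfl (chunk_mem f) le_rfl)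
      (hK.dft hp0 φ a)
    exact hK.mono this Set.subset_union_left subset_rfl (by omega)
  have hB' : K (Set.range f ∪ Set.range g) {e | ∃ i x, e = b' i x} (l * p ^ l * D * p) := by
    have := hK.comp (hK.mono (hK.start (Set.range g)) subset_rfl (chunk_mem g) le_rfl)
      (hK.dft hp0 φ b)
    exact hK.mono this Set.subset_union_right subset_rfl (by omega)
  have hPc : K ({e | ∃ i x, e = a' i x} ∪ {e | ∃ i x, e = b' i x}) {e | ∃ i x, e = P i x}
      (p ^ l * c) := by
    refine hK.mono (hK.iUnion Finset.univ fun i _ => hK.mono (hc (a' i) (b' i)) ?_ subset_rfl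
      le_rfl) subset_rfl ?_ (by simp [ZMod.card])
    · apply Set.union_subset_union
      · rintro _ ⟨x, rfl⟩; exact ⟨i, x, rfl⟩
      · rintro _ ⟨x, rfl⟩; exact ⟨i, x, rfl⟩
    · rintro _ ⟨i, x, rfl⟩
      simp only [Set.mem_iUnion]
      exact ⟨i, Finset.mem_univ _, x, rfl⟩
  have hTc : K {e | ∃ i x, e = P i x} {e | ∃ t x, e = T t x} (l * p ^ l * D * p) :=
    hK.dft hp0 (-φ) P
  have hUc : K {e | ∃ t x, e = T t x} {e | ∃ t x, e = U t x} (p ^ l * D) := by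
    refine hK.mono (hK.image (a := 1) (f := fun y : ZMod (p ^ l) × ZMod D => U y.1 y.2)
      Finset.univ fun y _ => hK.mono (hK.sub (T y.1 y.2) (T y.1 (y.2 - π))) ?_ subset_rfl le_rfl)
      subset_rfl ?_ (by simp [ZMod.card])
    · rintro _ (rfl | rfl)
      exacts [⟨_, _, rfl⟩, ⟨_, _, rfl⟩]
    · rintro _ ⟨t, x, rfl⟩
      exact ⟨(t, x), Finset.mem_univ _, rfl⟩
  have hVc : K {e | ∃ t x, e = U t x} {e | ∃ t x, e = V t x} (p ^ l * D) := by
    refine hK.mono (hK.image (a := 1) (f := fun y : ZMod (p ^ l) × ZMod D => V y.1 y.2)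
      Finset.univ fun y _ => hK.mono (hK.smul _ (U y.1 y.2)) ?_ subset_rfl le_rfl)
      subset_rfl ?_ (by simp [ZMod.card])
    · rintro _ rfl
      exact ⟨_, _, rfl⟩
    · rintro _ ⟨t, x, rfl⟩
      exact ⟨(t, x), Finset.mem_univ _, rfl⟩
  -- On the window below `2 * B` the copy shifted by `π` vanishes, so the difference already is `p ^
  -- l` times the wanted sum.
  have hV' : ∀ t x, x.val < 2 * B → V t x = ∑ j, cyclicConv β (a j) (b (t - j)) x := by
    intro t x hx
    have h1 : U t x = p ^ l • (∑ j, cyclicConv β (a j) (b (t - j)) x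
        - ∑ j, cyclicConv β (a j) (b (t - j)) (x - π)) := by
      refine cyclicConv_dft β φ π hφ a b T (fun t x => ?_) t x
      simp only [hT, hP, ha', hb', AddMonoidHom.neg_apply, sub_neg_eq_add]
      exact Finset.sum_congr rfl fun i _ => by rw [mul_comm t i]
    have h2 : ∑ j, cyclicConv β (a j) (b (t - j)) (x - π) = 0 :=
      Finset.sum_eq_zero fun j _ =>
        cyclicConv_chunk_eq_zero β ψ f g _ _ _ (ZMod.le_val_sub hB hD x hx)
    rw [h2, sub_zero] at h1
    have h3 : ((p ^ l : ℕ) : F) ≠ 0 := by rw [Nat.cast_pow]; exact pow_ne_zero _ hp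
    simp only [hV]
    rw [h1, ← Nat.cast_smul_eq_nsmul F, smul_smul, inv_mul_cancel₀ h3, one_smul]
  have hRc : K {e | ∃ t x, e = V t x} (Set.range (cyclicConv β f g)) N := by
    refine hK.mono (hK.image (a := 1) (f := cyclicConv β f g) Finset.univ fun x _ => ?_)
      subset_rfl ?_ (by simp [ZMod.card])
    · have hBpos : 0 < B := by
        rcases Nat.eq_zero_or_pos B with h | h
        · exact absurd (by rw [hN, h, mul_zero]) (NeZero.ne N)
        · exact h
      have hx : x = ψ ((x.val / B : ℕ) : ZMod (p ^ l)) + ((x.val % B : ℕ) : ZMod N) := by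
        rw [hψ, ← Nat.cast_add, Nat.div_add_mod', ZMod.natCast_zmod_val]
      have hlt := Nat.mod_lt x.val hBpos
      have h1 := cyclicConv_eq_chunk β hN (by omega : 2 * B ≤ D) ψ hψ f g
        ((x.val / B : ℕ) : ZMod (p ^ l)) hlt
      rw [← hx, ← ha, ← hb, ← hV' _ _ (by rw [ZMod.val_cast_of_lt (by omega)]; omega),
        ← hV' _ _ (by rw [ZMod.val_cast_of_lt (by omega)]; omega)] at h1
      rw [h1]
      refine hK.mono (hK.add _ _) ?_ subset_rfl le_rfl
      rintro _ (rfl | rfl)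
      exacts [⟨_, _, rfl⟩, ⟨_, _, rfl⟩]
    · rintro _ ⟨x, rfl⟩
      exact ⟨x, Finset.mem_univ _, rfl⟩
  refine hK.mono (hK.comp (hK.comp (hK.comp (hK.comp (hK.comp (hK.union hA hB') hPc) hTc) hUc)
    hVc) hRc) subset_rfl subset_rfl (le_of_eq ?_)
  ring

theorem IsCostModel.cyclicConv_schoolbook {K : Set E → Set E → ℕ → Prop} (hK : IsCostModel β K)
    {N : ℕ} [NeZero N] (f g : ZMod N → E) :
    K (Set.range f ∪ Set.range g) (Set.range (cyclicConv β f g)) (2 * N * N) := by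
  have h1 : K (Set.range f ∪ Set.range g) {e | ∃ x y, e = β (f x) (g y)} (N * N) := by
    refine hK.mono (hK.image (a := 1) (f := fun y : ZMod N × ZMod N => β (f y.1) (g y.2))
      Finset.univ fun y _ => hK.mono (hK.mul (f y.1) (g y.2)) ?_ subset_rfl le_rfl)
      subset_rfl ?_ (by simp [ZMod.card])
    · rintro _ (rfl | rfl)
      exacts [Or.inl ⟨_, rfl⟩, Or.inr ⟨_, rfl⟩]
    · rintro _ ⟨t, x, rfl⟩
      exact ⟨(t, x), Finset.mem_univ _, rfl⟩
  refine hK.mono (hK.comp h1 (hK.image (a := N) (f := cyclicConv β f g) Finset.univ fun x _ => ?_))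
      subset_rfl ?_ ?_
  · refine hK.mono (hK.sum (I := {e | ∃ x y, e = β (f x) (g y)})
      (f := fun e => β (f e) (g (x - e))) Finset.univ fun e _ => ⟨_, _, rfl⟩) subset_rfl subset_rfl
      (by simp [ZMod.card])
  · rintro _ ⟨x, rfl⟩
    exact ⟨x, Finset.mem_univ _, rfl⟩
  · simp only [Finset.card_univ, ZMod.card]
    apply le_of_eq
    ring

/-- Per unit of length, a level multiplies the cost by `p ^ 2 ≤ 9`, because the chunks are padded
from `p ^ b` to `p ^ (b + 2)`, while `k - 5` at least halves. Since `9 < 2 ^ 5`, the fifth power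
absorbs the growth. -/
theorem IsCostModel.cyclicConv_fast {K : Set E → Set E → ℕ → Prop} (hK : IsCostModel β K)
    {p : ℕ} (hp : p.Prime) (hp3 : p ≤ 3) (hpF : (p : F) ≠ 0) :
    ∀ (k : ℕ) [NeZero (p ^ k)] (f g : ZMod (p ^ k) → E),
    K (Set.range f ∪ Set.range g) (Set.range (cyclicConv β f g))
      (5000 * p ^ k * (max 1 (k - 5)) ^ 5) := by
  intro k
  induction k using Nat.strong_induction_on with
  | _ k ih =>
  intro _ f g
  -- The schoolbook bound suffices here, as `2 * 3 ^ 7 ≤ 5000`.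
  rcases le_or_gt k 7 with hk | hk
  · refine hK.mono (hK.cyclicConv_schoolbook f g) subset_rfl subset_rfl ?_
    have h1 : p ^ k ≤ 3 ^ 7 :=
      (Nat.pow_le_pow_left hp3 k).trans (Nat.pow_le_pow_right (by norm_num) hk)
    have h2 : 1 ≤ (max 1 (k - 5)) ^ 5 := Nat.one_le_pow _ _ (by omega)
    calc 2 * p ^ k * p ^ k ≤ 5000 * p ^ k * 1 := by nlinarith [Nat.zero_le (p ^ k)]
      _ ≤ _ := Nat.mul_le_mul_left _ h2
  · obtain ⟨l, b, hlb, hk', hb⟩ : ∃ l b, k = l + b ∧ l ≤ b ∧ b = (k + 1) / 2 :=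
      ⟨k / 2, (k + 1) / 2, by omega, by omega, rfl⟩
    have : NeZero (p ^ l) := ⟨pow_ne_zero _ hp.ne_zero⟩
    have : NeZero (p ^ (b + 2)) := ⟨pow_ne_zero _ hp.ne_zero⟩
    obtain ⟨φ, hφ⟩ := ZMod.exists_root_of_unity (l := l) (k := b + 2) hp (by omega)
    have hp2 := hp.two_le
    have h := hK.cyclicConv_step (p := p) (l := l) (N := p ^ k) (B := p ^ b) (D := p ^ (b + 2))
      (π := p ^ (b + 1)) hpF (by rw [hlb, pow_add])
      (by rw [pow_succ, mul_comm]; exact Nat.mul_le_mul_left _ hp2)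
      (by rw [pow_succ p (b + 1), mul_comm]; exact Nat.mul_le_mul_left _ hp2) φ hφ
      (ih (b + 2) (by omega)) f g
    refine hK.mono h subset_rfl subset_rfl ?_
    set x := max 1 (b + 2 - 5) with hx
    obtain ⟨y, hy⟩ : ∃ y, k - 5 = y := ⟨_, rfl⟩
    have hy3 : 3 ≤ y := by omega
    -- The map from `k` to `b + 2` is roughly `k / 2 + 2`; the rounding in `b` makes 5 the offset
    -- that halves.
    have hxy : 2 * x ≤ y := by omega
    have hly : l ≤ 2 * y := by omega
    have hmax : max 1 (k - 5) = y := by omega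
    rw [hmax]
    have e1 : p ^ l * p ^ (b + 2) = p ^ k * p ^ 2 := by rw [hlb, ← pow_add, ← pow_add]; rfl
    have hxy5 : 32 * x ^ 5 ≤ y ^ 5 := by
      calc 32 * x ^ 5 = (2 * x) ^ 5 := by ring
        _ ≤ y ^ 5 := Nat.pow_le_pow_left hxy 5
    have hyy : y ≤ y ^ 5 := Nat.le_self_pow (by norm_num) y
    have q2 : p ^ 2 ≤ 9 := Nat.pow_le_pow_left hp3 2
    have q3 : p ^ 2 * p ≤ 27 := Nat.mul_le_mul q2 hp3
    calc 3 * (l * p ^ l * p ^ (b + 2) * p) + p ^ l * (5000 * p ^ (b + 2) * x ^ 5)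
          + 2 * (p ^ l * p ^ (b + 2)) + p ^ k
        = 3 * l * (p ^ l * p ^ (b + 2)) * p + 5000 * (p ^ l * p ^ (b + 2)) * x ^ 5
          + 2 * (p ^ l * p ^ (b + 2)) + p ^ k := by ring
      _ = p ^ k * (3 * l * (p ^ 2 * p) + 5000 * p ^ 2 * x ^ 5 + 2 * p ^ 2 + 1) := by
          rw [e1]; ring
      _ ≤ p ^ k * (3 * (2 * y) * 27 + 5000 * 9 * x ^ 5 + 2 * 9 + 1) := by gcongr
      _ ≤ p ^ k * (5000 * y ^ 5) := Nat.mul_le_mul_left _ (by omega)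
      _ = 5000 * p ^ k * y ^ 5 := by ring

end FastConvolution

/-! ### The inverse of a block-Hankel matrix -/

section HankelInverse

variable {R : Type*} [Ring R] {m : ℕ}

theorem Fin.sum_ite_val_eq (n : ℕ) (f : Fin m → R) :
    ∑ k : Fin m, (if (k : ℕ) = n then f k else 0) = if h : n < m then f ⟨n, h⟩ else 0 := by
  split_ifs with h
  · rw [Finset.sum_eq_single ⟨n, h⟩]
    · simp
    · intro k _ hk
      rw [if_neg fun h => hk (Fin.ext h)]
    · simp
  · refine Finset.sum_eq_zero fun k _ => if_neg ?_
    rintro rfl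
    exact h k.2

/-- The inverse of a Hankel matrix, multiplied by shifts, has displacement rank at most two. -/
theorem hankel_inverse_displacement {α q v qs vs : ℕ → R} {X : Matrix (Fin m) (Fin m) R}
    (hXH : X * (Matrix.of fun i j : Fin m => α (i + j)) = 1)
    (hHX : (Matrix.of fun i j : Fin m => α (i + j)) * X = 1)
    (hq : ∀ i : Fin m, ∑ j : Fin m, α (i + j) * q (m - 1 - j) = if (i : ℕ) = m - 1 then 1 else 0)
    (hv : ∀ i : Fin m, ∑ j : Fin m, α (i + j) * v (m - j) = -α (m + i))
    (hqs : ∀ j : Fin m, ∑ i : Fin m, qs (m - 1 - i) * α (i + j) = if (j : ℕ) = m - 1 then 1 else 0)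
    (hvs : ∀ j : Fin m, ∑ i : Fin m, vs (m - i) * α (i + j) = -α (m + j))
    (i j : Fin m) :
    (if _h : (j : ℕ) ≠ 0 then X i ⟨j - 1, by omega⟩ else 0)
      - (if _h : (i : ℕ) ≠ 0 then X ⟨i - 1, by omega⟩ j else 0)
      = q (m - 1 - i) * vs (m - j) - v (m - i) * qs (m - 1 - j) := by
  set H : Matrix (Fin m) (Fin m) R := Matrix.of fun i j : Fin m => α (i + j) with hH
  let Z : Matrix (Fin m) (Fin m) R := Matrix.of fun k j => if (k : ℕ) = j + 1 then 1 else 0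
  let W : Matrix (Fin m) (Fin m) R := Matrix.of fun k j => if (j : ℕ) = k + 1 then 1 else 0
  let Q : Matrix (Fin m) Unit R := Matrix.of fun i _ => q (m - 1 - i)
  let V : Matrix (Fin m) Unit R := Matrix.of fun i _ => v (m - i)
  let Qs : Matrix Unit (Fin m) R := Matrix.of fun _ i => qs (m - 1 - i)
  let Vs : Matrix Unit (Fin m) R := Matrix.of fun _ i => vs (m - i)
  -- Only the last row and the last column survive in the difference, and the four systems express
  -- them through `H * Q`, `H * V`, `Qs * H` and `Vs * H`.
  have key : W * H - H * Z = (H * Q) * (Vs * H) - (H * V) * (Qs * H) := by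
    ext i j
    have e1 : (W * H) i j = if (i : ℕ) + 1 < m then α (i + 1 + j) else 0 := by
      simp only [W, Matrix.mul_apply, Matrix.of_apply, ite_mul, one_mul, zero_mul]
      rw [Fin.sum_ite_val_eq]
      split_ifs <;> simp [hH]
    have e2 : (H * Z) i j = if (j : ℕ) + 1 < m then α (i + (j + 1)) else 0 := by
      simp only [Z, Matrix.mul_apply, Matrix.of_apply, mul_ite, mul_one, mul_zero]
      rw [Fin.sum_ite_val_eq]
      split_ifs <;> simp [hH]
    have e3 : (H * Q) i () = if (i : ℕ) = m - 1 then 1 else 0 := hq i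
    have e4 : (H * V) i () = -α (m + i) := hv i
    have e5 : (Qs * H) () j = if (j : ℕ) = m - 1 then 1 else 0 := hqs j
    have e6 : (Vs * H) () j = -α (m + j) := hvs j
    rw [Matrix.sub_apply, Matrix.sub_apply, Matrix.mul_apply (M := H * Q),
      Matrix.mul_apply (M := H * V), e1, e2]
    simp only [Finset.univ_unique, Finset.sum_singleton]
    rw [show (default : Unit) = () from rfl, e3, e4, e5, e6]
    have hi := i.2
    have hj := j.2
    by_cases h1 : (i : ℕ) = m - 1 <;> by_cases h2 : (j : ℕ) = m - 1
    -- In the corner the two occurrences of `α (2 * m - 1)` cancel, which is why this block is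
    -- arbitrary.
    · rw [if_neg (by omega), if_neg (by omega), if_pos h1, if_pos h2, h1, h2]; simp
    · rw [if_neg (by omega), if_pos (by omega), if_pos h1, if_neg h2,
        show (i : ℕ) + (j + 1) = m + j by omega]; simp
    · rw [if_pos (by omega), if_neg (by omega), if_neg h1, if_pos h2,
        show (i : ℕ) + 1 + j = m + i by omega]; simp
    · rw [if_pos (by omega), if_pos (by omega), if_neg h1, if_neg h2,
        show (i : ℕ) + 1 + j = i + (j + 1) by omega]; simp
  have h2 : X * W - Z * X = Q * Vs - V * Qs := by
    calc X * W - Z * X = X * W * (H * X) - (X * H) * Z * X := by rw [hHX, hXH]; simp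
      _ = X * (W * H - H * Z) * X := by simp only [Matrix.mul_sub, Matrix.sub_mul, Matrix.mul_assoc]
      _ = (X * H) * Q * Vs * (H * X) - (X * H) * V * Qs * (H * X) := by
          rw [key]; simp only [Matrix.mul_sub, Matrix.sub_mul, Matrix.mul_assoc]
      _ = Q * Vs - V * Qs := by rw [hHX, hXH]; simp
  have h3 := congrFun (congrFun h2 i) j
  have e1 : (X * W) i j = if h : (j : ℕ) ≠ 0 then X i ⟨j - 1, by omega⟩ else 0 := by
    simp only [W, Matrix.mul_apply, Matrix.of_apply, mul_ite, mul_one, mul_zero]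
    split_ifs with h
    · rw [Finset.sum_eq_single ⟨j - 1, by omega⟩]
      · rw [if_pos (by simp only; omega)]
      · intro k _ hk
        rw [if_neg]
        intro hjk
        exact hk (Fin.ext (by simp only; omega))
      · simp
    · exact Finset.sum_eq_zero fun k _ => if_neg (by omega)
  have e2 : (Z * X) i j = if h : (i : ℕ) ≠ 0 then X ⟨i - 1, by omega⟩ j else 0 := by
    simp only [Z, Matrix.mul_apply, Matrix.of_apply, ite_mul, one_mul, zero_mul]
    split_ifs with h
    · rw [Finset.sum_eq_single ⟨i - 1, by omega⟩]
      · rw [if_pos (by simp only; omega)]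
      · intro k _ hk
        rw [if_neg]
        intro hjk
        exact hk (Fin.ext (by simp only; omega))
      · simp
    · exact Finset.sum_eq_zero fun k _ => if_neg (by omega)
  rw [Matrix.sub_apply, Matrix.sub_apply, e1, e2] at h3
  rw [h3, Matrix.mul_apply, Matrix.mul_apply]
  simp [Q, V, Qs, Vs]

theorem hankel_inverse_last_row {α qs : ℕ → R} {X : Matrix (Fin m) (Fin m) R}
    (hHX : (Matrix.of fun i j : Fin m => α (i + j)) * X = 1)
    (hqs : ∀ j : Fin m, ∑ i : Fin m, qs (m - 1 - i) * α (i + j) = if (j : ℕ) = m - 1 then 1 else 0)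
    (i j : Fin m) (hi : (i : ℕ) = m - 1) : X i j = qs (m - 1 - j) := by
  let Qs : Matrix Unit (Fin m) R := Matrix.of fun _ i => qs (m - 1 - i)
  have h1 : Qs * (Matrix.of fun i j : Fin m => α (i + j)) * X = Qs := by
    rw [Matrix.mul_assoc, hHX, Matrix.mul_one]
  have h2 := congrFun (congrFun h1 ()) j
  rw [Matrix.mul_apply, Finset.sum_eq_single i] at h2
  · rw [show (Qs * (Matrix.of fun i j : Fin m => α (i + j))) () i = 1 from
      (hqs i).trans (if_pos hi), one_mul] at h2
    exact h2
  · intro k _ hk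
    rw [show (Qs * (Matrix.of fun i j : Fin m => α (i + j))) () k = 0 from
      (hqs k).trans (if_neg fun h => hk (Fin.ext (h.trans hi.symm))), zero_mul]
  · simp

/-- The off-diagonal representation of the inverse of a Hankel matrix. -/
theorem hankel_inverse_apply {α q v qs vs v' q' : ℕ → R} {X : Matrix (Fin m) (Fin m) R}
    (hXH : X * (Matrix.of fun i j : Fin m => α (i + j)) = 1)
    (hHX : (Matrix.of fun i j : Fin m => α (i + j)) * X = 1)
    (hq : ∀ i : Fin m, ∑ j : Fin m, α (i + j) * q (m - 1 - j) = if (i : ℕ) = m - 1 then 1 else 0)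
    (hv : ∀ i : Fin m, ∑ j : Fin m, α (i + j) * v (m - j) = -α (m + i))
    (hqs : ∀ j : Fin m, ∑ i : Fin m, qs (m - 1 - i) * α (i + j) = if (j : ℕ) = m - 1 then 1 else 0)
    (hvs : ∀ j : Fin m, ∑ i : Fin m, vs (m - i) * α (i + j) = -α (m + j))
    (hv0 : v' 0 = 1) (hv' : ∀ k, 0 < k → k < m → v' k = v k)
    (hq0 : q' 0 = 0) (hq' : ∀ k, k < m → q' (k + 1) = q k) (r : ℕ) :
    ∀ i j : Fin m, (i : ℕ) + r + 1 = m → X i j = ∑ k ∈ Finset.range (r + 1),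
      if k ≤ (j : ℕ) then
        v' (r - k) * qs (m - 1 - j + k) - q' (r - k) * vs (m - j + k) else 0 := by
  induction r with
  | zero =>
    intro i j hi
    rw [hankel_inverse_last_row hHX hqs i j (by omega)]
    simp [hv0, hq0]
  | succ r ih =>
    intro i j hi
    -- In row `i + 1` the displacement expresses `X i j` through its antidiagonal neighbour `X (i +
    -- 1) (j - 1)` and one new term, the summand `k = 0`.
    have h := hankel_inverse_displacement hXH hHX hq hv hqs hvs ⟨i + 1, by omega⟩ j
    rw [dif_pos (Nat.succ_ne_zero (i : ℕ))] at h
    simp only [Nat.add_sub_cancel, Fin.eta] at h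
    rw [Finset.sum_range_succ', if_pos (Nat.zero_le _), Nat.sub_zero, add_zero, add_zero,
      hv' (r + 1) (by omega) (by omega), hq' r (by omega)]
    rw [show m - 1 - ((i : ℕ) + 1) = r by omega, show m - ((i : ℕ) + 1) = r + 1 by omega] at h
    have h0 : (if h : (j : ℕ) ≠ 0 then X ⟨i + 1, by omega⟩ ⟨j - 1, by omega⟩ else 0)
        = ∑ k ∈ Finset.range (r + 1), if k + 1 ≤ (j : ℕ) then
        v' (r + 1 - (k + 1)) * qs (m - 1 - j + (k + 1))
          - q' (r + 1 - (k + 1)) * vs (m - j + (k + 1)) else 0 := by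
      split_ifs with hj
      · rw [ih _ _ (by simp only; omega)]
        refine Finset.sum_congr rfl fun k _ => ?_
        have hjm := j.2
        simp only [Nat.add_sub_add_right]
        by_cases hk : k + 1 ≤ (j : ℕ)
        · rw [if_pos hk, if_pos (by omega),
            show m - 1 - ((j : ℕ) - 1) + k = m - 1 - j + (k + 1) by omega,
            show m - ((j : ℕ) - 1) + k = m - j + (k + 1) by omega]
        · rw [if_neg hk, if_neg (by omega)]
      · exact (Finset.sum_eq_zero fun k _ => if_neg (by omega)).symm
    rw [h0] at h
    rw [sub_eq_iff_eq_add] at h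
    rw [h]
    abel

end HankelInverse

/-! ### Coefficients of products of matrix polynomials. -/

section MatrixConvolution

variable {A : Type*} [CommRing A] {s n : ℕ}

/-- The coefficients of the product of two matrix polynomials. -/
def matConv (p : ℕ → Matrix (Fin s) (Fin s) A) (r : ℕ → Matrix (Fin s) (Fin n) A) (t : ℕ) :
    Matrix (Fin s) (Fin n) A :=
  ∑ x ∈ Finset.HasAntidiagonal.antidiagonal t, p x.1 * r x.2

theorem matConv_map {B : Type*} [CommRing B] (φ : A →+* B) (p : ℕ → Matrix (Fin s) (Fin s) A)
    (r : ℕ → Matrix (Fin s) (Fin n) A) (t : ℕ) :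
    (matConv p r t).map φ = matConv (fun k => (p k).map φ) (fun k => (r k).map φ) t := by
  unfold matConv
  ext i j
  simp [Matrix.sum_apply, Matrix.mul_apply]

theorem coeff_mul_eq_matConv (P : Matrix (Fin s) (Fin s) (Polynomial A))
    (Q : Matrix (Fin s) (Fin n) (Polynomial A)) (i j t) :
    ((P * Q) i j).coeff t = matConv (fun k => P.map fun f => f.coeff k)
      (fun k => Q.map fun f => f.coeff k) t i j := by
  simp only [matConv, Matrix.mul_apply, Polynomial.finsetSum_coeff, Polynomial.coeff_mul,
    Matrix.sum_apply, Matrix.map_apply]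
  exact Finset.sum_comm

/-- The coefficients from `c` upwards are the product of an upper triangular block-Toeplitz matrix
by a block column. -/
theorem matConv_add_eq {p : ℕ → Matrix (Fin s) (Fin s) A} {r : ℕ → Matrix (Fin s) (Fin n) A}
    {c m : ℕ} (hm : m ≤ c + 1) (hp : ∀ a, c < a → p a = 0) (hr : ∀ b, m ≤ b → r b = 0) (k : ℕ) :
    matConv p r (c + k)
      = ∑ j ∈ Finset.range m, if k ≤ j then p (c - j + k) * r j else 0 := by
  unfold matConv
  rw [← Finset.Nat.sum_antidiagonal_swap, Finset.Nat.sum_antidiagonal_eq_sum_range_succ_mk]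
  symm
  refine Finset.sum_subset_zero_on_sdiff ?_ ?_ ?_
  · intro j; simp only [Finset.mem_range]; omega
  · intro j hj
    simp only [Finset.mem_sdiff, Finset.mem_range, not_lt] at hj
    simp [hr j hj.2]
  · intro j hj
    have := Finset.mem_range.1 hj
    simp only [Prod.swap]
    split_ifs with h
    · rw [show c - j + k = c + k - j by omega]
    · rw [hp _ (by omega), Matrix.zero_mul]

/-- The matrix polynomial of degree at most `d` with coefficients `p`. -/
noncomputable def polyMat {t : ℕ} (d : ℕ) (p : ℕ → Matrix (Fin s) (Fin t) A) :
    Matrix (Fin s) (Fin t) (Polynomial A) :=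
  Matrix.of fun i j => ∑ k ∈ Finset.range (d + 1), Polynomial.monomial k (p k i j)

theorem polyMat_coeff {t d : ℕ} {p : ℕ → Matrix (Fin s) (Fin t) A} (hp : ∀ k, d < k → p k = 0)
    (i j k) : (polyMat d p i j).coeff k = p k i j := by
  simp only [polyMat, Matrix.of_apply, Polynomial.finsetSum_coeff, Polynomial.coeff_monomial,
    Finset.sum_ite_eq', Finset.mem_range]
  split_ifs with h
  · rfl
  · rw [hp k (by omega)]; rfl

theorem polyMat_natDegree_le {t d : ℕ} (p : ℕ → Matrix (Fin s) (Fin t) A) (i j) :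
    (polyMat d p i j).natDegree ≤ d := by
  rw [polyMat, Matrix.of_apply]
  refine Polynomial.natDegree_sum_le_of_forall_le _ _ fun k hk => ?_
  have := Finset.mem_range.1 hk
  exact (Polynomial.natDegree_monomial_le _).trans (by omega)

theorem polyMatProd_matConv {F X : Type*} [Field F] {d : ℕ} {S : Set (X → F)}
    {p : ℕ → Matrix (Fin s) (Fin s) (X → F)} {r : ℕ → Matrix (Fin s) (Fin n) (X → F)}
    (hp : ∀ k, d < k → p k = 0) (hr : ∀ k, d < k → r k = 0)
    (hpS : ∀ k i j, p k i j ∈ S) (hrS : ∀ k i j, r k i j ∈ S) :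
    PolyMatProd d s n S {f | ∃ i j k, f = matConv p r k i j} := by
  refine ⟨polyMat d p, polyMat d r, fun i j => ⟨polyMat_natDegree_le _ _ _, fun k => ?_⟩,
    fun i j => ⟨polyMat_natDegree_le _ _ _, fun k => ?_⟩, ?_⟩
  · rw [polyMat_coeff hp]; exact hpS k i j
  · rw [polyMat_coeff hr]; exact hrS k i j
  · have h1 : ∀ k, (polyMat d p).map (fun f => f.coeff k) = p k := fun k => by
      ext1 i j; exact polyMat_coeff hp i j k
    have h2 : ∀ k, (polyMat d r).map (fun f => f.coeff k) = r k := fun k => by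
      ext1 i j; exact polyMat_coeff hr i j k
    simp only [coeff_mul_eq_matConv, h1, h2]

end MatrixConvolution

/-! ### The product with the inverse by four polynomial products -/

section InverseProduct

variable {F : Type*} [Field F] {m s : ℕ}

/-- The blocks `v 1, …, v (m - 1)` preceded by the identity. -/
def vSeq (m s : ℕ) (k : ℕ) : Matrix (Fin s) (Fin s) (HankelInput F m s → F) :=
  if k = 0 then 1 else if k < m then Matrix.of fun i j x => x.v k i j else 0

/-- The blocks `q 0, …, q (m - 1)` preceded by zero. -/
def qSeq (m s : ℕ) (k : ℕ) : Matrix (Fin s) (Fin s) (HankelInput F m s → F) :=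
  if 0 < k ∧ k ≤ m then Matrix.of fun i j x => x.q (k - 1) i j else 0

/-- The blocks `qs 0, …, qs (m - 1)`. -/
def qsSeq (m s : ℕ) (k : ℕ) : Matrix (Fin s) (Fin s) (HankelInput F m s → F) :=
  if k < m then Matrix.of fun i j x => x.qs k i j else 0

/-- The blocks `vs 1, …, vs m`. -/
def vsSeq (m s : ℕ) (k : ℕ) : Matrix (Fin s) (Fin s) (HankelInput F m s → F) :=
  if 0 < k ∧ k ≤ m then Matrix.of fun i j x => x.vs k i j else 0

/-- The blocks of `M`. -/
def mSeq (m s : ℕ) (k : ℕ) : Matrix (Fin s) (Fin (m * s)) (HankelInput F m s → F) :=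
  if h : k < m then Matrix.of fun i j x => x.M (⟨k, h⟩, i) j else 0

/-- The blocks of the product of the block-Toeplitz matrix of the `qs k` by `M`. -/
def uSeq (m s : ℕ) (k : ℕ) : Matrix (Fin s) (Fin (m * s)) (HankelInput F m s → F) :=
  if k < m then matConv (qsSeq m s) (mSeq m s) (m - 1 + k) else 0

/-- The blocks of the product of the block-Toeplitz matrix of the `vs k` by `M`. -/
def wSeq (m s : ℕ) (k : ℕ) : Matrix (Fin s) (Fin (m * s)) (HankelInput F m s → F) :=
  if k < m then matConv (vsSeq m s) (mSeq m s) (m + k) else 0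

/-- Exchanging the sums in `hankel_inverse_apply` lets the Toeplitz factors act on `M` first, giving
`uSeq` and `wSeq`; the remaining sums over `k` are again convolutions. -/
theorem inverse_mul_apply (x : HankelInput F m s) (i : Fin m) (a : Fin s) (c : Fin (m * s)) :
    ((blockHankel m s x.α)⁻¹ * x.M) (i, a) c
      = matConv (vSeq m s) (uSeq m s) (m - 1 - i) a c x
        - matConv (qSeq m s) (wSeq m s) (m - 1 - i) a c x := by
  have hm : 0 < m := i.pos
  -- The Hankel identities are applied to `m × m` matrices over the noncommutative ring of `s × s`
  -- blocks.
  let e := Matrix.compRingEquiv (Fin m) (Fin s) F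
  let H : Matrix (Fin m) (Fin m) (Matrix (Fin s) (Fin s) F) := Matrix.of fun i j => x.α (i + j)
  let X : Matrix (Fin m) (Fin m) (Matrix (Fin s) (Fin s) F) :=
    Matrix.of fun i j => Matrix.of fun a b => (blockHankel m s x.α)⁻¹ (i, a) (j, b)
  have hH : e H = blockHankel m s x.α := rfl
  have hX : e X = (blockHankel m s x.α)⁻¹ := rfl
  have hXH : X * H = 1 := by
    apply e.injective
    rw [map_mul, hH, hX, Matrix.nonsing_inv_mul _ x.nonsing, map_one]
  have hHX : H * X = 1 := by
    apply e.injective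
    rw [map_mul, hH, hX, Matrix.mul_nonsing_inv _ x.nonsing, map_one]
  have hq : ∀ i : Fin m, ∑ j : Fin m, x.α (i + j) * x.q (m - 1 - j)
      = if (i : ℕ) = m - 1 then 1 else 0 := by
    intro i
    ext a c
    have := congrFun (congrFun x.q_eq (i, a)) c
    rw [Matrix.mul_apply, Fintype.sum_prod_type] at this
    simpa [Matrix.sum_apply, Matrix.mul_apply, blockHankel, blockCol] using this
  have hv : ∀ i : Fin m, ∑ j : Fin m, x.α (i + j) * x.v (m - j) = -x.α (m + i) := by
    intro i
    ext a c
    have := congrFun (congrFun x.v_eq (i, a)) c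
    rw [Matrix.mul_apply, Fintype.sum_prod_type] at this
    simpa [Matrix.sum_apply, Matrix.mul_apply, blockHankel, blockCol] using this
  have hqs : ∀ j : Fin m, ∑ i : Fin m, x.qs (m - 1 - i) * x.α (i + j)
      = if (j : ℕ) = m - 1 then 1 else 0 := by
    intro i
    ext a c
    have := congrFun (congrFun x.qs_eq a) (i, c)
    rw [Matrix.mul_apply, Fintype.sum_prod_type] at this
    simpa [Matrix.sum_apply, Matrix.mul_apply, blockHankel, blockRow] using this
  have hvs : ∀ j : Fin m, ∑ i : Fin m, x.vs (m - i) * x.α (i + j) = -x.α (m + j) := by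
    intro i
    ext a c
    have := congrFun (congrFun x.vs_eq a) (i, c)
    rw [Matrix.mul_apply, Fintype.sum_prod_type] at this
    simpa [Matrix.sum_apply, Matrix.mul_apply, blockHankel, blockRow] using this
  let v' : ℕ → Matrix (Fin s) (Fin s) F := fun k => (vSeq m s k).map (Pi.evalRingHom _ x)
  let q' : ℕ → Matrix (Fin s) (Fin s) F := fun k => (qSeq m s k).map (Pi.evalRingHom _ x)
  let qs' : ℕ → Matrix (Fin s) (Fin s) F := fun k => (qsSeq m s k).map (Pi.evalRingHom _ x)
  let vs' : ℕ → Matrix (Fin s) (Fin s) F := fun k => (vsSeq m s k).map (Pi.evalRingHom _ x)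
  let M' : ℕ → Matrix (Fin s) (Fin (m * s)) F := fun k => (mSeq m s k).map (Pi.evalRingHom _ x)
  have hinv := hankel_inverse_apply (v' := v') (q' := q') hXH hHX hq hv hqs hvs
    (by ext a b; by_cases h : a = b <;> simp [v', vSeq, Matrix.one_apply, h])
    (by intro k h0 h1; ext a b; simp [v', vSeq, h0.ne', h1])
    (by ext a b; simp [q', qSeq])
    (by intro k h0; ext a b; simp [q', qSeq, Nat.succ_le_of_lt h0])
    (m - 1 - i) i
  have hqs' : ∀ k, k < m → qs' k = x.qs k := by
    intro k hk; ext a b; simp [qs', qsSeq, hk]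
  have hvs' : ∀ k, 0 < k → k ≤ m → vs' k = x.vs k := by
    intro k h0 hk; ext a b; simp [vs', vsSeq, hk, h0]
  have hM' : ∀ k, m ≤ k → M' k = 0 := by
    intro k hk; ext a b; simp [M', mSeq, hk.not_gt]
  have hu : ∀ k < m, (uSeq m s k).map (Pi.evalRingHom _ x)
      = ∑ j : Fin m, if k ≤ (j : ℕ) then x.qs (m - 1 - j + k) * M' j else 0 := by
    intro k hk
    rw [uSeq, if_pos hk, matConv_map, matConv_add_eq (m := m) (by omega)
      (by intro a ha; ext; simp [qsSeq, show ¬ a < m by omega]) hM', Finset.sum_range]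
    refine Finset.sum_congr rfl fun j _ => ?_
    split_ifs with h
    · rw [← hqs' _ (by omega)]
    · rfl
  have hw : ∀ k < m, (wSeq m s k).map (Pi.evalRingHom _ x)
      = ∑ j : Fin m, if k ≤ (j : ℕ) then x.vs (m - j + k) * M' j else 0 := by
    intro k hk
    rw [wSeq, if_pos hk, matConv_map, matConv_add_eq (m := m) (by omega)
      (by intro a ha; ext; simp [vsSeq, show ¬ a ≤ m by omega]) hM', Finset.sum_range]
    refine Finset.sum_congr rfl fun j _ => ?_
    split_ifs with h
    · rw [← hvs' _ (by omega) (by omega)]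
    · rfl
  have h1 : matConv (vSeq m s) (uSeq m s) (m - 1 - i) a c x
      = matConv v' (fun k => (uSeq m s k).map (Pi.evalRingHom _ x)) (m - 1 - i) a c := by
    rw [← matConv_map]; rfl
  have h2 : matConv (qSeq m s) (wSeq m s) (m - 1 - i) a c x
      = matConv q' (fun k => (wSeq m s k).map (Pi.evalRingHom _ x)) (m - 1 - i) a c := by
    rw [← matConv_map]; rfl
  have h3 : ((blockHankel m s x.α)⁻¹ * x.M) (i, a) c = (∑ j : Fin m, X i j * M' j) a c := by
    rw [Matrix.mul_apply, Fintype.sum_prod_type]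
    simp [Matrix.sum_apply, Matrix.mul_apply, X, M', mSeq]
  rw [h1, h2, h3, ← Matrix.sub_apply]
  refine congrFun (congrFun ?_ a) c
  unfold matConv
  rw [← Finset.sum_sub_distrib, ← Finset.Nat.sum_antidiagonal_swap,
    Finset.Nat.sum_antidiagonal_eq_sum_range_succ_mk]
  simp only [Prod.swap]
  have h4 : ∀ k ∈ Finset.range (m - 1 - i).succ,
      v' (m - 1 - i - k) * (uSeq m s k).map (Pi.evalRingHom _ x)
        - q' (m - 1 - i - k) * (wSeq m s k).map (Pi.evalRingHom _ x)
      = ∑ j : Fin m, (if k ≤ (j : ℕ) then v' (m - 1 - i - k) * x.qs (m - 1 - j + k)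
          - q' (m - 1 - i - k) * x.vs (m - j + k) else 0) * M' j := by
    intro k hk
    have hk := Finset.mem_range.1 hk
    rw [hu k (by omega), hw k (by omega), Matrix.mul_sum, Matrix.mul_sum,
      ← Finset.sum_sub_distrib]
    refine Finset.sum_congr rfl fun j _ => ?_
    split_ifs
    · rw [Matrix.sub_mul, Matrix.mul_assoc, Matrix.mul_assoc]
    · simp
  rw [Finset.sum_congr rfl h4, Finset.sum_comm]
  refine Finset.sum_congr rfl fun j _ => ?_
  rw [hinv j (by omega), Matrix.sum_mul]

theorem exists_straightLine_inverse_mul (hm : 0 < m) :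
    ∃ (a : ℕ) (S : Set (HankelInput F m s → F)),
      StraightLine (PolyMatProd m s (m * s)) (givenValues F m s) a 4 S ∧
      wantedValues F m s ⊆ S ∧ a ≤ (m * s) ^ 2 := by
  set I := givenValues F m s with hI
  set S₀ : Set (HankelInput F m s → F) := I ∪ {f | ∃ c : F, f = fun _ => c} with hS₀
  have h0 : (0 : HankelInput F m s → F) ∈ S₀ := Or.inr ⟨0, rfl⟩
  have h1 : (1 : HankelInput F m s → F) ∈ S₀ := Or.inr ⟨1, rfl⟩
  have hq : ∀ k i j, qSeq (F := F) m s k i j ∈ S₀ := by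
    intro k i j
    unfold qSeq
    split_ifs with h
    · exact Or.inl (Or.inl (Or.inl (Or.inl (Or.inl ⟨k - 1, i, j, by omega, rfl⟩))))
    · exact h0
  have hv : ∀ k i j, vSeq (F := F) m s k i j ∈ S₀ := by
    intro k i j
    unfold vSeq
    split_ifs with h h'
    · rw [Matrix.one_apply]; split_ifs
      exacts [h1, h0]
    · exact Or.inl (Or.inl (Or.inl (Or.inl (Or.inr ⟨k, i, j, by omega, by omega, rfl⟩))))
    · exact h0
  have hqs : ∀ k i j, qsSeq (F := F) m s k i j ∈ S₀ := by
    intro k i j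
    unfold qsSeq
    split_ifs with h
    · exact Or.inl (Or.inl (Or.inl (Or.inr ⟨k, i, j, h, rfl⟩)))
    · exact h0
  have hvs : ∀ k i j, vsSeq (F := F) m s k i j ∈ S₀ := by
    intro k i j
    unfold vsSeq
    split_ifs with h
    · exact Or.inl (Or.inl (Or.inr ⟨k, i, j, by omega, by omega, rfl⟩))
    · exact h0
  have hM : ∀ k i j, mSeq (F := F) m s k i j ∈ S₀ := by
    intro k i j
    unfold mSeq
    split_ifs with h
    · exact Or.inl (Or.inr ⟨(⟨k, h⟩, i), j, rfl⟩)
    · exact h0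
  have dq : ∀ k, m < k → qSeq (F := F) m s k = 0 := fun k hk => if_neg (by omega)
  have dv : ∀ k, m < k → vSeq (F := F) m s k = 0 := fun k hk => by
    rw [vSeq, if_neg (by omega), if_neg (by omega)]
  have dqs : ∀ k, m < k → qsSeq (F := F) m s k = 0 := fun k hk => if_neg (by omega)
  have dvs : ∀ k, m < k → vsSeq (F := F) m s k = 0 := fun k hk => if_neg (by omega)
  have dM : ∀ k, m < k → mSeq (F := F) m s k = 0 := fun k hk => dif_neg (by omega)
  have du : ∀ k, m < k → uSeq (F := F) m s k = 0 := fun k hk => if_neg (by omega)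
  have dw : ∀ k, m < k → wSeq (F := F) m s k = 0 := fun k hk => if_neg (by omega)
  set T₁ : Set (HankelInput F m s → F) :=
    {f | ∃ i j k, f = matConv (qsSeq m s) (mSeq m s) k i j} with hT₁
  set T₂ : Set (HankelInput F m s → F) :=
    {f | ∃ i j k, f = matConv (vsSeq m s) (mSeq m s) k i j} with hT₂
  set T₃ : Set (HankelInput F m s → F) :=
    {f | ∃ i j k, f = matConv (vSeq m s) (uSeq m s) k i j} with hT₃
  set T₄ : Set (HankelInput F m s → F) :=
    {f | ∃ i j k, f = matConv (qSeq m s) (wSeq m s) k i j} with hT₄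
  -- All coefficients passed to the four calls are given, returned by earlier calls, or the
  -- constants 0 and 1, so no arithmetic is needed in between.
  have P₁ : StraightLine (PolyMatProd m s (m * s)) I 0 1 (S₀ ∪ T₁) :=
    StraightLine.start.call (polyMatProd_matConv dqs dM hqs hM)
  have P₂ : StraightLine (PolyMatProd m s (m * s)) I 0 2 (S₀ ∪ T₁ ∪ T₂) :=
    P₁.call (polyMatProd_matConv dvs dM (fun k i j => Or.inl (hvs k i j))
      fun k i j => Or.inl (hM k i j))
  have hu : ∀ k i j, uSeq (F := F) m s k i j ∈ S₀ ∪ T₁ := by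
    intro k i j
    unfold uSeq
    split_ifs
    · exact Or.inr ⟨_, _, _, rfl⟩
    · exact Or.inl h0
  have hw : ∀ k i j, wSeq (F := F) m s k i j ∈ S₀ ∪ T₁ ∪ T₂ := by
    intro k i j
    unfold wSeq
    split_ifs
    · exact Or.inr ⟨_, _, _, rfl⟩
    · exact Or.inl (Or.inl h0)
  have P₃ : StraightLine (PolyMatProd m s (m * s)) I 0 3 (S₀ ∪ T₁ ∪ T₂ ∪ T₃) :=
    P₂.call (polyMatProd_matConv dv du (fun k i j => Or.inl (Or.inl (hv k i j)))
      fun k i j => Or.inl (hu k i j))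
  have P₄ : StraightLine (PolyMatProd m s (m * s)) I 0 4 (S₀ ∪ T₁ ∪ T₂ ∪ T₃ ∪ T₄) :=
    P₃.call (polyMatProd_matConv dq dw (fun k i j => Or.inl (Or.inl (Or.inl (hq k i j))))
      fun k i j => Or.inl (hw k i j))
  have hcost : CostLE (S₀ ∪ T₁ ∪ T₂ ∪ T₃ ∪ T₄) (wantedValues F m s) ((m * s : ℕ) ^ 2) := by
    refine (CostLE.iUnion (ι := (Fin m × Fin s) × Fin (m * s)) (t := 1) fun y =>
      CostLE.sub (f := matConv (vSeq m s) (uSeq m s) (m - 1 - y.1.1) y.1.2 y.2)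
        (g := matConv (qSeq m s) (wSeq m s) (m - 1 - y.1.1) y.1.2 y.2)
        (Or.inl (Or.inr ⟨_, _, _, rfl⟩)) (Or.inr ⟨_, _, _, rfl⟩)).mono subset_rfl ?_ ?_
    · rintro _ ⟨i, c, rfl⟩
      simp only [Set.mem_iUnion, Set.mem_singleton_iff]
      refine ⟨(i, c), ?_⟩
      funext x
      exact inverse_mul_apply x i.1 i.2 c
    · simp only [Fintype.card_prod, Fintype.card_fin]
      push_cast
      apply le_of_eq
      ring
  obtain ⟨a, S, hS, hO, ha⟩ := hcost
  obtain ⟨S', h1, -, h3⟩ := P₄.append hS subset_rfl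
  exact ⟨_, S', h1, hO.trans h3, by rw [zero_add]; exact_mod_cast ha⟩

end InverseProduct

/-! ### The cost of polynomial matrix products -/

section MatrixProducts

variable {F X : Type*} [Field F]

theorem CostLE.of_union_const {I O : Set (X → F)} {t : ℝ}
    (h : CostLE (I ∪ {f | ∃ c : F, f = fun _ => c}) O t) : CostLE I O t :=
  ((CostLE.start I).append (h.mono Set.subset_union_right subset_rfl le_rfl)).mono subset_rfl
    Set.subset_union_right (by simp)

theorem MatMulCostLE.restrict {a b c c' : ℕ} {t : ℝ} (h : MatMulCostLE F a b c t) (hc : c' ≤ c) :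
    MatMulCostLE F a b c' t := by
  refine CostLE.comap (fun x => (x.1, Matrix.of fun i (j : Fin c) =>
    if hj : (j : ℕ) < c' then x.2 i ⟨j, hj⟩ else 0)) h ?_ ?_
  · rintro _ (⟨i, j, rfl⟩ | ⟨i, j, rfl⟩)
    · exact Or.inl (Or.inl ⟨i, j, rfl⟩)
    · by_cases hj : (j : ℕ) < c'
      · refine Or.inl (Or.inr ⟨i, ⟨j, hj⟩, ?_⟩)
        funext x
        simp [hj]
      · refine Or.inr ⟨0, ?_⟩
        funext x
        simp [hj]
  · rintro _ ⟨i, j, rfl⟩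
    refine ⟨_, ⟨i, Fin.castLE hc j, rfl⟩, ?_⟩
    funext x
    simp [Matrix.mul_apply]

theorem MatMulCostLE.blocks {a b c : ℕ} {t : ℝ} (h : MatMulCostLE F a b c t) (m : ℕ) :
    MatMulCostLE F a b (m * c) (m * t) := by
  refine (CostLE.iUnion (ι := Fin m) (t := t)
    (O := fun k => {f | ∃ i j, f = fun x => (x.1 * x.2) i (finProdFinEquiv (k, j))})
    fun k => CostLE.comap (fun x => (x.1, Matrix.of fun i (j : Fin c) =>
      x.2 i (finProdFinEquiv (k, j)))) h ?_ ?_).mono subset_rfl ?_ (by simp)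
  · rintro _ (⟨i, j, rfl⟩ | ⟨i, j, rfl⟩)
    · exact Or.inl (Or.inl ⟨i, j, rfl⟩)
    · exact Or.inl (Or.inr ⟨i, _, rfl⟩)
  · rintro _ ⟨i, j, rfl⟩
    exact ⟨_, ⟨i, j, rfl⟩, rfl⟩
  · rintro _ ⟨i, j, rfl⟩
    simp only [Set.mem_iUnion]
    refine ⟨(finProdFinEquiv.symm j).1, i, (finProdFinEquiv.symm j).2, ?_⟩
    rw [Prod.mk.eta, Equiv.apply_symm_apply]

/-- Pairs of matrices that can be multiplied with each other. -/
abbrev MatPair (F X : Type*) (s n : ℕ) : Type _ :=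
  Matrix (Fin s) (Fin s) (X → F) × Matrix (Fin s) (Fin n) (X → F)

/-- The product of the first matrix of a pair and the second matrix of another one. -/
def matPairMul (F X : Type*) [Field F] (s n : ℕ) :
    MatPair F X s n →ₗ[F] MatPair F X s n →ₗ[F] MatPair F X s n :=
  LinearMap.mk₂ F (fun x y => (0, x.1 * y.2))
    (by intros; simp [Matrix.add_mul]) (by intros; simp)
    (by intros; simp [Matrix.mul_add]) (by intros; simp)

/-- All entries of the matrices in a set of pairs. -/
def entries {F X : Type*} {s n : ℕ} (I : Set (MatPair F X s n)) : Set (X → F) :=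
  {f | ∃ e ∈ I, (∃ i j, f = e.1 i j) ∨ ∃ i j, f = e.2 i j}

theorem entries_mono {F X : Type*} {s n : ℕ} {I J : Set (MatPair F X s n)} (h : I ⊆ J) :
    entries I ⊆ entries J := by
  rintro f ⟨e, he, hf⟩
  exact ⟨e, h he, hf⟩

theorem entries_union {F X : Type*} {s n : ℕ} (I J : Set (MatPair F X s n)) :
    entries (I ∪ J) = entries I ∪ entries J := by
  ext f
  constructor
  · rintro ⟨e, he | he, hf⟩
    exacts [Or.inl ⟨e, he, hf⟩, Or.inr ⟨e, he, hf⟩]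
  · rintro (⟨e, he, hf⟩ | ⟨e, he, hf⟩)
    exacts [⟨e, Or.inl he, hf⟩, ⟨e, Or.inr he, hf⟩]

theorem costLE_entries_singleton {s n : ℕ} {I : Set (X → F)} {e : MatPair F X s n}
    (h1 : ∀ i j, CostLE I {e.1 i j} 1) (h2 : ∀ i j, CostLE I {e.2 i j} 1) :
    CostLE I (entries {e}) ((s : ℝ) * s + s * n) := by
  refine ((CostLE.iUnion (ι := Fin s × Fin s) fun y => h1 y.1 y.2).append
    ((CostLE.iUnion (ι := Fin s × Fin n) fun y => h2 y.1 y.2).mono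
      Set.subset_union_left subset_rfl le_rfl)).mono subset_rfl ?_ (by simp)
  rintro f ⟨_, rfl, ⟨i, j, rfl⟩ | ⟨i, j, rfl⟩⟩
  · exact Or.inl (Set.mem_iUnion.2 ⟨(i, j), rfl⟩)
  · exact Or.inr (Set.mem_iUnion.2 ⟨(i, j), rfl⟩)

/-- Pairing a left with a right factor makes multiplication a bilinear map on a single space, as the
convolution algorithm requires. By `hsn`, entrywise operations on a pair cost no more than a
product. -/
theorem isCostModel_costLE_entries {s n : ℕ} {T : ℝ} (hT : MatMulCostLE F s s n T)
    (hsn : (s : ℝ) * s + s * n ≤ T) :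
    IsCostModel (matPairMul F X s n) fun I O a => CostLE (entries I) (entries O) (a * T) := by
  have hT0 : 0 ≤ T := le_trans (by positivity) hsn
  have fst_mem : ∀ {I : Set (MatPair F X s n)} {e}, e ∈ I → ∀ i j, e.1 i j ∈ entries I :=
    fun he i j => ⟨_, he, Or.inl ⟨i, j, rfl⟩⟩
  have snd_mem : ∀ {I : Set (MatPair F X s n)} {e}, e ∈ I → ∀ i j, e.2 i j ∈ entries I :=
    fun he i j => ⟨_, he, Or.inr ⟨i, j, rfl⟩⟩
  refine ⟨fun h hI hO ha => h.mono (entries_mono hI) (entries_mono hO) (by gcongr), fun I => ?_,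
    fun h h' => ?_, fun x y => ?_, fun x y => ?_, fun c x => ?_, fun x y => ?_⟩
  · refine (CostLE.of_subset ?_).mono subset_rfl subset_rfl (by simp)
    rintro f ⟨e, rfl | he, hf⟩
    · refine Or.inr ⟨0, ?_⟩
      rcases hf with ⟨i, j, rfl⟩ | ⟨i, j, rfl⟩ <;> rfl
    · exact Or.inl ⟨e, he, hf⟩
  · rw [entries_union] at h' ⊢
    exact (h.append h').mono subset_rfl subset_rfl (by push_cast; linarith)
  · refine (costLE_entries_singleton (fun i j => ?_) fun i j => ?_).mono subset_rfl subset_rfl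
      (by simpa using hsn)
    · exact CostLE.add (fst_mem (Or.inl rfl) i j) (fst_mem (Or.inr rfl) i j)
    · exact CostLE.add (snd_mem (Or.inl rfl) i j) (snd_mem (Or.inr rfl) i j)
  · refine (costLE_entries_singleton (fun i j => ?_) fun i j => ?_).mono subset_rfl subset_rfl
      (by simpa using hsn)
    · exact CostLE.sub (fst_mem (Or.inl rfl) i j) (fst_mem (Or.inr rfl) i j)
    · exact CostLE.sub (snd_mem (Or.inl rfl) i j) (snd_mem (Or.inr rfl) i j)
  · refine (costLE_entries_singleton (fun i j => ?_) fun i j => ?_).mono subset_rfl subset_rfl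
      (by simpa using hsn)
    · exact CostLE.smul c (fst_mem (Set.mem_singleton x) i j)
    · exact CostLE.smul c (snd_mem (Set.mem_singleton x) i j)
  · have h1 : CostLE (entries {x, y}) {f | ∃ i j, f = (x.1 * y.2) i j} T := by
      refine CostLE.comap (fun z => (x.1.map fun f => f z, y.2.map fun f => f z)) hT ?_ ?_
      · rintro _ (⟨i, j, rfl⟩ | ⟨i, j, rfl⟩)
        · exact Or.inl (fst_mem (Or.inl rfl) i j)
        · exact Or.inl (snd_mem (Or.inr rfl) i j)
      · rintro _ ⟨i, j, rfl⟩
        refine ⟨_, ⟨i, j, rfl⟩, ?_⟩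
        funext z
        simp [Matrix.mul_apply]
    refine ((CostLE.start _).append (h1.mono Set.subset_union_left subset_rfl le_rfl)).mono
      subset_rfl ?_ (by simp)
    rintro f ⟨_, rfl, ⟨i, j, rfl⟩ | ⟨i, j, rfl⟩⟩
    · exact Or.inl (Or.inr ⟨0, rfl⟩)
    · exact Or.inr ⟨i, j, rfl⟩

/-- Wrapped-around terms have indices with sum `t + N > 2 * d`, so one of them exceeds `d`. -/
theorem matConv_eq_cyclicConv {s n d N : ℕ} [NeZero N] (hN : 2 * d < N)
    {p : ℕ → Matrix (Fin s) (Fin s) (X → F)} {r : ℕ → Matrix (Fin s) (Fin n) (X → F)}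
    (hp : ∀ k, d < k → p k = 0) (hr : ∀ k, d < k → r k = 0) {t : ℕ} (ht : t < N) :
    (cyclicConv (matPairMul F X s n) (fun x : ZMod N => (p x.val, 0)) (fun x => (0, r x.val)) t).2
      = matConv p r t := by
  unfold cyclicConv matConv
  rw [Prod.snd_sum, ZMod.sum_eq_sum_range, Finset.Nat.sum_antidiagonal_eq_sum_range_succ_mk]
  symm
  refine Finset.sum_subset_zero_on_sdiff ?_ ?_ ?_
  · intro k; simp only [Finset.mem_range]; omega
  · intro k hk
    simp only [Finset.mem_sdiff, Finset.mem_range, not_lt] at hk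
    have h1 : (t : ZMod N) - (k : ZMod N) = ((t + N - k : ℕ) : ZMod N) := by
      rw [Nat.cast_sub (by omega)]
      simp
    rw [h1]
    simp only [matPairMul, LinearMap.mk₂_apply]
    rw [ZMod.val_cast_of_lt hk.1, ZMod.val_cast_of_lt (by omega)]
    rcases le_or_gt k d with h | h
    · rw [hr (t + N - k) (by omega), Matrix.mul_zero]
    · rw [hp k h, Matrix.zero_mul]
  · intro k hk
    have hk := Finset.mem_range.1 hk
    rw [← Nat.cast_sub (by omega : k ≤ t)]
    simp only [matPairMul, LinearMap.mk₂_apply]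
    rw [ZMod.val_cast_of_lt (by omega), ZMod.val_cast_of_lt (by omega)]

theorem exists_prime_le_three_ne_zero (F : Type*) [Field F] :
    ∃ p : ℕ, p.Prime ∧ p ≤ 3 ∧ (p : F) ≠ 0 := by
  by_cases h : (2 : F) = 0
  · refine ⟨3, Nat.prime_three, le_rfl, ?_⟩
    have : (3 : F) = 2 + 1 := by norm_num
    push_cast
    rw [this, h, zero_add]
    exact one_ne_zero
  · exact ⟨2, Nat.prime_two, by norm_num, by exact_mod_cast h⟩

theorem clog_bounds {p m : ℕ} (hp : 2 ≤ p) (hp3 : p ≤ 3) (hm : 0 < m) :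
    (p : ℝ) ^ Nat.clog p (2 * m + 1) ≤ 6 * m ∧
      (Nat.clog p (2 * m + 1) : ℝ) ≤ 2 * (1 + Real.log m) := by
  obtain ⟨k, hk⟩ : ∃ k, Nat.clog p (2 * m + 1) = k + 1 :=
    ⟨_, (Nat.succ_pred_eq_of_pos (Nat.clog_pos hp (by omega))).symm⟩
  have h1 : p ^ k < 2 * m + 1 := by
    have := Nat.pow_pred_clog_lt_self (b := p) (x := 2 * m + 1) hp (by omega)
    rwa [hk] at this
  have h2 : p ^ k ≤ 2 * m := by omega
  rw [hk]
  constructor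
  · have : p ^ (k + 1) ≤ 6 * m := by
      calc p ^ (k + 1) = p ^ k * p := pow_succ _ _
        _ ≤ (2 * m) * 3 := Nat.mul_le_mul h2 hp3
        _ = 6 * m := by ring
    exact_mod_cast this
  · have h3 : (2 : ℝ) ^ k ≤ 2 * m := by
      exact_mod_cast (Nat.pow_le_pow_left hp k).trans h2
    have h4 := Real.log_le_log (by positivity) h3
    have hm' : (1 : ℝ) ≤ m := by exact_mod_cast hm
    rw [Real.log_pow, Real.log_mul (by norm_num) (by positivity)] at h4
    have h5 := Real.log_two_gt_d9
    have h6 := Real.log_nonneg hm'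
    push_cast
    have hk0 : (0 : ℝ) ≤ k := Nat.cast_nonneg k
    by_contra! hlt
    nlinarith

/-- The product of polynomial matrices of degree at most `d` over any field takes quasi-linearly
many products of matrices over this field. -/
theorem PolyMatProd.costLE {d s n : ℕ} (hd : 0 < d) {T : ℝ} (hT : MatMulCostLE F s s n T)
    (hsn : (s : ℝ) * s + s * n ≤ T) {S O : Set (X → F)} (h : PolyMatProd d s n S O) :
    CostLE S O (960000 * d * (1 + Real.log d) ^ 5 * T) := by
  obtain ⟨P, Q, hP, hQ, rfl⟩ := h
  obtain ⟨p, hp, hp3, hpF⟩ := exists_prime_le_three_ne_zero F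
  have hT0 : 0 ≤ T := le_trans (by positivity) hsn
  set k := Nat.clog p (2 * d + 1) with hk
  have hN : 2 * d < p ^ k := Nat.le_pow_clog hp.one_lt _
  have : NeZero (p ^ k) := ⟨by omega⟩
  have h1 := (isCostModel_costLE_entries (X := X) hT hsn).cyclicConv_fast hp hp3 hpF k
    (fun x => (P.map (fun f => f.coeff x.val), 0)) (fun x => (0, Q.map fun f => f.coeff x.val))
  have hP0 : ∀ t, d < t → P.map (fun f => f.coeff t) = 0 := by
    intro t ht
    ext1 i j
    exact Polynomial.coeff_eq_zero_of_natDegree_lt ((hP i j).1.trans_lt ht)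
  have hQ0 : ∀ t, d < t → Q.map (fun f => f.coeff t) = 0 := by
    intro t ht
    ext1 i j
    exact Polynomial.coeff_eq_zero_of_natDegree_lt ((hQ i j).1.trans_lt ht)
  refine CostLE.of_union_const (((CostLE.start _).append
    (h1.mono Set.subset_union_left subset_rfl le_rfl)).mono ?_ ?_ ?_)
  · rintro f ⟨e, ⟨x, rfl⟩ | ⟨x, rfl⟩, ⟨i, j, rfl⟩ | ⟨i, j, rfl⟩⟩
    · exact Or.inl ((hP i j).2 _)
    · exact Or.inr ⟨0, rfl⟩
    · exact Or.inr ⟨0, rfl⟩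
    · exact Or.inl ((hQ i j).2 _)
  · rintro f ⟨i, j, t, rfl⟩
    rcases lt_or_ge t (p ^ k) with ht | ht
    · refine Or.inr ⟨_, ⟨(t : ZMod (p ^ k)), rfl⟩, Or.inr ⟨i, j, ?_⟩⟩
      rw [matConv_eq_cyclicConv hN hP0 hQ0 ht, coeff_mul_eq_matConv]
    · refine Or.inl (Or.inr ⟨0, ?_⟩)
      rw [coeff_mul_eq_matConv, matConv, Finset.sum_eq_zero]
      · rfl
      · intro y hy
        have hy := Finset.HasAntidiagonal.mem_antidiagonal.1 hy
        rcases le_or_gt y.1 d with h | h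
        · rw [hQ0 y.2 (by omega), Matrix.mul_zero]
        · rw [hP0 y.1 h, Matrix.zero_mul]
  · obtain ⟨h2, h3⟩ := clog_bounds hp.two_le hp3 hd
    rw [← hk] at h2 h3
    have hk1 : 1 ≤ k := Nat.clog_pos hp.one_lt (by omega)
    have h4 : ((max 1 (k - 5) : ℕ) : ℝ) ≤ 2 * (1 + Real.log d) :=
      le_trans (by exact_mod_cast (by omega : max 1 (k - 5) ≤ k)) h3
    rw [zero_add]
    push_cast at h4 ⊢
    -- The constant is `5000 * 6 * 2 ^ 5`.
    calc 5000 * (p : ℝ) ^ k * max 1 ((k - 5 : ℕ) : ℝ) ^ 5 * T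
        ≤ 5000 * (6 * d) * (2 * (1 + Real.log d)) ^ 5 * T := by gcongr
      _ = 960000 * d * (1 + Real.log d) ^ 5 * T := by ring

end MatrixProducts

/-! ### The main theorem -/

/-- The four calls are replaced by fast products, so everything is reduced to the cost `T` of one
scalar product of `s × s` by `s × n` matrices. -/
theorem costLE_inverse_mul {F : Type*} [Field F] {m s : ℕ} (hm : 0 < m) (hs : 0 < s) {T : ℝ}
    (hT : MatMulCostLE F s s (m * s) T) :
    CostLE (givenValues F m s) (wantedValues F m s)
      (8000000 * m * (1 + Real.log ((m : ℝ) * s)) ^ 5 * T) := by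
  have h1 := hT.le hs
  push_cast at h1
  have hm1 : (1 : ℝ) ≤ m := by exact_mod_cast hm
  have hs1 : (1 : ℝ) ≤ s := by exact_mod_cast hs
  have h2 : (s : ℝ) * s ≤ s * (m * s) := by
    gcongr
    exact le_mul_of_one_le_left (by positivity) hm1
  have hT0 : 0 ≤ T := le_trans (by positivity) h1
  obtain ⟨a, S, hS, hO, ha⟩ := exists_straightLine_inverse_mul (F := F) (s := s) hm
  -- Both `s * s` and `s * (m * s)` are at most `T`, so `2 * T` pays for entrywise operations on
  -- pairs.
  have h3 := hS.costLE fun S O h => PolyMatProd.costLE (T := 2 * T) hm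
    (hT.mono subset_rfl subset_rfl (by linarith)) (by push_cast; linarith) h
  refine h3.mono subset_rfl hO ?_
  have h4 : (a : ℝ) ≤ m * T := by
    have : (a : ℝ) ≤ ((m : ℝ) * s) ^ 2 := by exact_mod_cast ha
    calc (a : ℝ) ≤ ((m : ℝ) * s) ^ 2 := this
      _ = m * (s * (m * s)) := by ring
      _ ≤ m * T := by gcongr
  have h5 : Real.log m ≤ Real.log ((m : ℝ) * s) :=
    Real.log_le_log (by positivity) (le_mul_of_one_le_right (by positivity) hs1)
  have h6 : 0 ≤ Real.log m := Real.log_nonneg hm1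
  have h7 : (1 : ℝ) ≤ (1 + Real.log ((m : ℝ) * s)) ^ 5 := one_le_pow₀ (by linarith)
  have h8 : (1 + Real.log m) ^ 5 ≤ (1 + Real.log ((m : ℝ) * s)) ^ 5 := by gcongr
  have hmT : 0 ≤ (m : ℝ) * T := by positivity
  push_cast
  -- Four calls contribute `4 * 960000 * 2 = 7680000` and the subtractions at most 1, in units of `m
  -- * T` times the logarithmic factor.
  nlinarith [mul_le_mul_of_nonneg_left h7 hmT, mul_le_mul_of_nonneg_left h8 hmT]

theorem corollaryA2 {F : Type*} [Field F] :
    (∀ m s : ℕ, 0 < m → 0 < s →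
      ∃ (a : ℕ) (S : Set (HankelInput F m s → F)),
        StraightLine (PolyMatProd m s (m * s)) (givenValues F m s) a 4 S ∧
        wantedValues F m s ⊆ S ∧ a ≤ (m * s) ^ 2) ∧
    (∀ ν τ : ℝ, IsRectMatMulExponent F ν τ →
      ∃ (C : ℝ) (k : ℕ), ∀ m s : ℕ, 0 < m → 0 < s → (m : ℝ) * (s : ℝ) ≤ (s : ℝ) ^ ν →
        CostLE (givenValues F m s) (wantedValues F m s)
          (C * ((s : ℝ) ^ τ * (m : ℝ)) * (1 + Real.log ((m : ℝ) * (s : ℝ))) ^ k)) ∧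
    (∀ ω : ℝ, IsMatMulExponent F ω →
      ∃ (C : ℝ) (k : ℕ), ∀ m s : ℕ, 0 < m → 0 < s →
        CostLE (givenValues F m s) (wantedValues F m s)
          (C * ((s : ℝ) ^ ω * (m : ℝ) ^ 2) * (1 + Real.log ((m : ℝ) * (s : ℝ))) ^ k)) := by
  refine ⟨fun m s hm _ => exists_straightLine_inverse_mul hm, ?_, ?_⟩
  · rintro ν τ ⟨c, hc⟩
    refine ⟨8000000 * c, 5, fun m s hm hs hms => ?_⟩
    -- The integer `m * s` survives rounding down, so the rectangular product is wide enough and its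
    -- surplus columns are set to zero.
    have h1 : m * s ≤ ⌊(s : ℝ) ^ ν⌋₊ := Nat.le_floor (by exact_mod_cast hms)
    refine (costLE_inverse_mul hm hs ((hc s hs).restrict h1)).mono subset_rfl subset_rfl ?_
    apply le_of_eq
    ring
  · rintro ω ⟨c, hc⟩
    refine ⟨8000000 * c, 5, fun m s hm hs => ?_⟩
    refine (costLE_inverse_mul hm hs ((hc s hs).blocks m)).mono subset_rfl subset_rfl ?_
    apply le_of_eq
    ring
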